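/- **Setting.** Identify $S^2\subset\mathbb R^3$ with $\mathbb{CP}^1$ by stereographic projection $y\mapsto\lambda=\frac{y_2+iy_3}{1+y_1}$. Let $$Z=\mathbb{CP}^3\setminus\big(\{z_2=z_3=0\}\sqcup\{z_0=z_1=0\}\big),\qquad \pi:Z\to\mathbb{CP}^1\times\mathbb{CP}^1,\quad [z_0:z_1:z_2:z_3]\mapsto(\eta_1,\eta_2)=\Big(\frac{z_1}{z_0},\frac{z_3}{z_2}\Big).$$ For a real-valued smooth function $h$ on $S^2\cong\mathbb{CP}^1$ let $P_h\subset Z$ be the set of points having homogeneous coordinates with $z_3=\bar z_0e^{-h(z_1/z_0)}$ and $z_2=\bar z_1e^{-h(z_1/z_0)}$. Let $\mathbb D=\{|\omega|\le1\}$. For $(t,\lambda)\in\mathbb R\times\mathbb{CP}^1$ let the standard disk $\underline D_{(t,\lambda)}\subset\mathbb{CP}^1\times\mathbb{CP}^1$ be the image of $$\mathbb D\ni\omega\mapsto(\eta_1(\omega),\eta_2(\omega))=\Big(\frac{-\omega+\lambda e^t}{\bar\lambda\omega+e^t},\ \frac{\lambda+e^t\omega}{-1+\bar\lambda e^t\omega}\Big),$$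 where for $\lambda=\infty$ one takes $\omega\mapsto(e^t/\omega,\ 1/(e^t\omega))$, the limit as $\lambda\to\infty$ after the rotation $\omega\mapsto(\lambda/\bar\lambda)\omega$ of $\mathbb D$. A holomorphic disk in $Z$ with boundary on $P_h$ is the image of an injective map $\mathbb D\to Z$ that is smooth up to the boundary, holomorphic in the interior, and maps $\partial\mathbb D$ into $P_h$. A family of such disks is smooth if locally in the index the disks are parametrized by $\mathbb D$, smoothly and jointly in the index and the point of $\mathbb D$. **Proposition.** Let $h:S^2\to\mathbb R$ be smooth. There is a smooth family $\{\mathfrak D_{(s,t,\lambda)}\}$ of holomorphic disks in $Z$ with boundaries on $P_h$, indexed by $(s,t,\lambda)\in S^1\times\mathbb R\times\mathbb{CP}^1$, such that $\pi$ maps each $\mathfrak D_{(s,t,\lambda)}$ biholomorphically onto $\underline D_{(t,\lambda)}$. It is given explicitly as follows. Put $H(t,\lambda;\omega)=h(\eta_1(\omega))$ for $|\omega|=1$, with Fourier coefficients $H_k=H_k(t,\lambda)=\frac1{2\pi}\int_0^{2\pi}H(t,\lambda;e^{i\theta})e^{-ik\theta}\,d\theta$, and $H_\pm(\omega)=\sum_{\pm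 k>0}H_k\omega^k$. Then $\sum_{k\in\mathbb Z}H_k\omega^k$ converges absolutely and $H=H_-+H_0+H_+$ for $|\omega|=1$, and $\mathfrak D_{(s,t,\lambda)}$ is the image of $$\mathbb D\ni\omega\mapsto\big[e^{2H_++H_0+is}\Phi:\ e^{2H_++H_0+is}\Phi\,\eta_1:\ \eta_2^{-1}:\ 1\big],\qquad \Phi=-i\,\frac{\bar\lambda\omega+e^t}{\lambda+e^t\omega}$$ (denominators cleared; for $\lambda=\infty$ this reads $[-ie^{2H_++H_0+is}\omega:-ie^{2H_++H_0+is}e^t:e^t\omega:1]$). The family is unique up to the choice of the parameter $s$, in the following sense. 1. For every $(t,\lambda)$, each holomorphic disk in $Z$ with boundary on $P_h$ that $\pi$ maps biholomorphically onto $\underline D_{(t,\lambda)}$ equals $\mathfrak D_{(s,t,\lambda)}$ for exactly one $s\in S^1$. 2. If $\{\mathfrak D'_{(s,t,\lambda)}\}$ is another smooth family of holomorphic disks in $Z$ with boundaries on $P_h$, indexed by $S^1\times\mathbb R\times\mathbb{CP}^1$, such that $\pi$ maps each $\mathfrak D'_{(s,t,\lambda)}$ biholomorphically onto $\underline D_{(t,\lambda)}$,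 then $\mathfrak D'_{(s,t,\lambda)}=\mathfrak D_{(\sigma(s,t,\lambda),t,\lambda)}$ for a unique smooth map $\sigma:S^1\times\mathbb R\times\mathbb{CP}^1\to S^1$. -/

import Mathlib

open scoped Manifold ContDiff ComplexConjugate LinearAlgebra.Projectivization

noncomputable section

namespace TwistorDisks

/-! ### The sphere, the projective line and stereographic projection -/

/-- The unit sphere `S²` in Euclidean `ℝ³`, a smooth manifold (Mathlib's structure). -/
abbrev S2 : Type := Metric.sphere (0 : EuclideanSpace ℝ (Fin 3)) 1

/-- The complex projective line; `[p₀ : p₁]` has affine coordinate `p₁ / p₀`. -/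
abbrev CP1 : Type := ℙ ℂ (Fin 2 → ℂ)

/-- Complex projective three-space. -/
abbrev CP3 : Type := ℙ ℂ (Fin 4 → ℂ)

lemma vec2_ne_zero {a b : ℂ} (h : ¬(a = 0 ∧ b = 0)) : (![a, b] : Fin 2 → ℂ) ≠ 0 := by
  intro h0
  exact h ⟨by simpa using congrFun h0 0, by simpa using congrFun h0 1⟩

/-- The point `[a : b]` of the projective line. -/
def cp1 (a b : ℂ) (h : ¬(a = 0 ∧ b = 0)) : CP1 := Projectivization.mk ℂ ![a, b] (vec2_ne_zero h)

/-- Homogeneous coordinates `(l₀, l₁)` of the point `λ = (y₂ + i y₃) / (1 + y₁)` of the projective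
line given by stereographic projection of `y ∈ S²`: they are `(1, λ)` if `λ ≠ ∞`, and `(0, 1)` if
`λ = ∞`, i.e. if `y = (-1, 0, 0)`. -/
def homCoord (y : S2) : ℂ × ℂ :=
  if y.1 0 = -1 then (0, 1)
  else (1, ((y.1 1 : ℂ) + Complex.I * (y.1 2 : ℂ)) / (1 + (y.1 0 : ℂ)))

lemma homCoord_ne_zero (y : S2) : ¬((homCoord y).1 = 0 ∧ (homCoord y).2 = 0) := by
  unfold homCoord
  split_ifs <;> simp

/-- Stereographic projection `S² → ℂP¹`. -/
def stereo (y : S2) : CP1 := cp1 (homCoord y).1 (homCoord y).2 (homCoord_ne_zero y)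

/-- For a nonzero vector `(p₀, p₁)`, the point of `S²` whose stereographic projection is
`[p₀ : p₁]`. -/
def invStereoVec (p : {v : Fin 2 → ℂ // v ≠ 0}) : EuclideanSpace ℝ (Fin 3) :=
  !₂[(Complex.normSq (p.1 0) - Complex.normSq (p.1 1)) /
        (Complex.normSq (p.1 0) + Complex.normSq (p.1 1)),
     2 * (conj (p.1 0) * p.1 1).re / (Complex.normSq (p.1 0) + Complex.normSq (p.1 1)),
     2 * (conj (p.1 0) * p.1 1).im / (Complex.normSq (p.1 0) + Complex.normSq (p.1 1))]

lemma normSq_add_pos (p : {v : Fin 2 → ℂ // v ≠ 0}) :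
    0 < Complex.normSq (p.1 0) + Complex.normSq (p.1 1) := by
  rcases p with ⟨v, hv⟩
  by_contra hcon
  have h0 := Complex.normSq_nonneg (v 0)
  have h1 := Complex.normSq_nonneg (v 1)
  simp only at hcon
  have e0 : v 0 = 0 := Complex.normSq_eq_zero.1 (by linarith)
  have e1 : v 1 = 0 := Complex.normSq_eq_zero.1 (by linarith)
  apply hv
  ext i
  fin_cases i
  · exact e0
  · exact e1

lemma invStereoVec_mem (p : {v : Fin 2 → ℂ // v ≠ 0}) :
    invStereoVec p ∈ Metric.sphere (0 : EuclideanSpace ℝ (Fin 3)) 1 := by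
  have h := normSq_add_pos p
  rw [mem_sphere_zero_iff_norm, EuclideanSpace.norm_eq, Real.sqrt_eq_one]
  simp only [invStereoVec, Fin.sum_univ_three, Real.norm_eq_abs, sq_abs]
  simp only [Matrix.cons_val_zero, Matrix.cons_val_one, Matrix.cons_val]
  field_simp
  simp only [Complex.normSq_apply, Complex.mul_re, Complex.mul_im, Complex.conj_re,
    Complex.conj_im]
  ring

lemma invStereoVec_smul (a b : {v : Fin 2 → ℂ // v ≠ 0}) (t : ℂ)
    (h : (a : Fin 2 → ℂ) = t • (b : Fin 2 → ℂ)) : invStereoVec a = invStereoVec b := by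
  have ha := normSq_add_pos a
  have hb := normSq_add_pos b
  have e0 : a.1 0 = t * b.1 0 := by rw [h]; rfl
  have e1 : a.1 1 = t * b.1 1 := by rw [h]; rfl
  rw [e0, e1, map_mul, map_mul] at ha
  have ht : Complex.normSq t ≠ 0 := by
    intro h0
    rw [h0] at ha
    simp at ha
  have key : conj (t * b.1 0) * (t * b.1 1)
      = (Complex.normSq t : ℂ) * (conj (b.1 0) * b.1 1) := by
    rw [map_mul, Complex.normSq_eq_conj_mul_self]
    ring
  unfold invStereoVec
  rw [e0, e1, key, map_mul, map_mul, Complex.re_ofReal_mul, Complex.im_ofReal_mul]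
  have hs : Complex.normSq t * Complex.normSq (b.1 0) + Complex.normSq t * Complex.normSq (b.1 1)
      = Complex.normSq t * (Complex.normSq (b.1 0) + Complex.normSq (b.1 1)) := by ring
  have hd : Complex.normSq t * Complex.normSq (b.1 0) - Complex.normSq t * Complex.normSq (b.1 1)
      = Complex.normSq t * (Complex.normSq (b.1 0) - Complex.normSq (b.1 1)) := by ring
  rw [hs, hd, mul_div_mul_left _ _ ht, mul_left_comm 2, mul_div_mul_left _ _ ht,
    mul_left_comm 2, mul_div_mul_left _ _ ht]

/-- The inverse `ℂP¹ → S²` of stereographic projection. -/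
def invStereo : CP1 → S2 :=
  Projectivization.lift (fun p => ⟨invStereoVec p, invStereoVec_mem p⟩)
    (fun a b t h => Subtype.ext (invStereoVec_smul a b t h))

lemma sphere_eq (y : S2) : y.1 0 ^ 2 + y.1 1 ^ 2 + y.1 2 ^ 2 = 1 := by
  have h := y.2
  rw [mem_sphere_zero_iff_norm, EuclideanSpace.norm_eq, Real.sqrt_eq_one] at h
  simpa [Fin.sum_univ_three] using h

lemma homCoord_eq_of_ne (y : S2) (hy : y.1 0 ≠ -1) :
    homCoord y = (1, (((y.1 1 / (1 + y.1 0) : ℝ) : ℂ) +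
      ((y.1 2 / (1 + y.1 0) : ℝ) : ℂ) * Complex.I)) := by
  rw [homCoord, if_neg hy]
  push_cast
  ring_nf

lemma invStereo_stereo (y : S2) : invStereo (stereo y) = y := by
  have hs := sphere_eq y
  apply Subtype.ext
  change invStereoVec ⟨![(homCoord y).1, (homCoord y).2], _⟩ = y.1
  by_cases hy : y.1 0 = -1
  · have h1 : y.1 1 = 0 := by nlinarith [sq_nonneg (y.1 1), sq_nonneg (y.1 2)]
    have h2 : y.1 2 = 0 := by nlinarith [sq_nonneg (y.1 1), sq_nonneg (y.1 2)]
    ext i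
    fin_cases i <;> simp [invStereoVec, homCoord, hy, h1, h2]
  · have hne : 1 + y.1 0 ≠ 0 := fun h => hy (by linarith)
    simp only [invStereoVec, homCoord_eq_of_ne y hy, Matrix.cons_val_zero, Matrix.cons_val_one]
    generalize hu : y.1 1 / (1 + y.1 0) = u
    generalize hv : y.1 2 / (1 + y.1 0) = v
    have hu' : y.1 1 = u * (1 + y.1 0) := by rw [← hu]; field_simp
    have hv' : y.1 2 = v * (1 + y.1 0) := by rw [← hv]; field_simp
    have hden : 1 + (u ^ 2 + v ^ 2) = 2 / (1 + y.1 0) := by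
      rw [hu', hv'] at hs
      rw [eq_div_iff hne]
      apply mul_right_cancel₀ hne
      linear_combination hs
    have hden' : u ^ 2 + v ^ 2 = 2 / (1 + y.1 0) - 1 := by linarith
    rw [Complex.normSq_add_mul_I, map_one, map_one, one_mul, hden, hden']
    ext i
    fin_cases i
    · simp
      field_simp
      ring
    · simp [hu']
      field_simp
    · simp [hv']
      field_simp

lemma stereo_invStereo (p : CP1) : stereo (invStereo p) = p := by
  induction p using Projectivization.ind with | h v hv =>
  have hN := normSq_add_pos ⟨v, hv⟩
  simp only at hN
  have e0 : (invStereo (Projectivization.mk ℂ v hv)).1 0 =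
    (Complex.normSq (v 0) - Complex.normSq (v 1)) /
      (Complex.normSq (v 0) + Complex.normSq (v 1)) := rfl
  have e1 : (invStereo (Projectivization.mk ℂ v hv)).1 1 =
    2 * (conj (v 0) * v 1).re / (Complex.normSq (v 0) + Complex.normSq (v 1)) := rfl
  have e2 : (invStereo (Projectivization.mk ℂ v hv)).1 2 =
    2 * (conj (v 0) * v 1).im / (Complex.normSq (v 0) + Complex.normSq (v 1)) := rfl
  refine (Projectivization.mk_eq_mk_iff' ℂ _ _ _ _).2 ?_
  by_cases h0 : v 0 = 0
  · have hy : (invStereo (Projectivization.mk ℂ v hv)).1 0 = -1 := by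
      simp only [h0, map_zero, zero_add, zero_sub] at hN e0
      rw [e0, neg_div, div_self hN.ne']
    have h1 : v 1 ≠ 0 := by
      intro h1
      simp [h0, h1] at hN
    refine ⟨(v 1)⁻¹, ?_⟩
    rw [homCoord, if_pos hy]
    ext i
    fin_cases i <;> simp [h0, h1]
  · have hp : 0 < Complex.normSq (v 0) := Complex.normSq_pos.2 h0
    have hs : 1 + (invStereo (Projectivization.mk ℂ v hv)).1 0 =
        2 * Complex.normSq (v 0) / (Complex.normSq (v 0) + Complex.normSq (v 1)) := by
      rw [e0]
      field_simp
      ring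
    have hy : (invStereo (Projectivization.mk ℂ v hv)).1 0 ≠ -1 := by
      intro h
      have : (0 : ℝ) < 1 + (invStereo (Projectivization.mk ℂ v hv)).1 0 := by
        rw [hs]
        positivity
      linarith
    have key : (homCoord (invStereo (Projectivization.mk ℂ v hv))) = (1, v 1 / v 0) := by
      rw [homCoord_eq_of_ne _ hy, hs, e1, e2]
      congr 1
      have r1 : 2 * (conj (v 0) * v 1).re / (Complex.normSq (v 0) + Complex.normSq (v 1)) /
          (2 * Complex.normSq (v 0) / (Complex.normSq (v 0) + Complex.normSq (v 1))) =
          (conj (v 0) * v 1).re / Complex.normSq (v 0) := by field_simp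
      have r2 : 2 * (conj (v 0) * v 1).im / (Complex.normSq (v 0) + Complex.normSq (v 1)) /
          (2 * Complex.normSq (v 0) / (Complex.normSq (v 0) + Complex.normSq (v 1))) =
          (conj (v 0) * v 1).im / Complex.normSq (v 0) := by field_simp
      have hc : conj (v 0) ≠ 0 := by simpa using h0
      rw [r1, r2, Complex.ofReal_div, Complex.ofReal_div, div_mul_eq_mul_div, ← add_div,
        Complex.re_add_im, Complex.normSq_eq_conj_mul_self, mul_div_mul_left _ _ hc]
    refine ⟨(v 0)⁻¹, ?_⟩
    rw [key]
    ext i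
    fin_cases i <;> simp [h0, div_eq_inv_mul]

/-! ### The twistor space `Z`, its projection to `W = ℂP¹ × ℂP¹`, and the real submanifold -/

/-- The line `{z₂ = z₃ = 0}`. -/
def lineP : Set CP3 := {p | p.rep 2 = 0 ∧ p.rep 3 = 0}

/-- The line `{z₀ = z₁ = 0}`. -/
def lineM : Set CP3 := {p | p.rep 0 = 0 ∧ p.rep 1 = 0}

lemma rep_zero_iff (v : Fin 4 → ℂ) (hv : v ≠ 0) (i j : Fin 4) :
    ((Projectivization.mk ℂ v hv).rep i = 0 ∧ (Projectivization.mk ℂ v hv).rep j = 0) ↔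
      (v i = 0 ∧ v j = 0) := by
  obtain ⟨a, ha⟩ := Projectivization.exists_smul_eq_mk_rep ℂ v hv
  rw [← ha]
  simp [Units.smul_def]

/-- `Z`, the complement in `ℂP³` of the two lines. -/
def Z : Type := {p : CP3 // p ∉ lineP ∪ lineM}

lemma vec4_ne_zero {a b c d : ℂ} (h : ¬(a = 0 ∧ b = 0)) : (![a, b, c, d] : Fin 4 → ℂ) ≠ 0 := by
  intro h0
  exact h ⟨by simpa using congrFun h0 0, by simpa using congrFun h0 1⟩

/-- The point `[a : b : c : d]` of `Z`. -/
def zpt (a b c d : ℂ) (h : ¬(a = 0 ∧ b = 0)) (h' : ¬(c = 0 ∧ d = 0)) : Z :=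
  ⟨Projectivization.mk ℂ ![a, b, c, d] (vec4_ne_zero h), by
    rintro (h0 | h0)
    · exact h' (by simpa using (rep_zero_iff _ _ 2 3).1 h0)
    · exact h (by simpa using (rep_zero_iff _ _ 0 1).1 h0)⟩

/-- The projection `π : Z → ℂP¹ × ℂP¹`, `[z₀ : z₁ : z₂ : z₃] ↦ ([z₀ : z₁], [z₂ : z₃])`, in affine
coordinates `(η₁, η₂) = (z₁ / z₀, z₃ / z₂)`. -/
def proj (p : Z) : CP1 × CP1 :=
  (cp1 (p.1.rep 0) (p.1.rep 1) (fun h => p.2 (Or.inr h)),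
   cp1 (p.1.rep 2) (p.1.rep 3) (fun h => p.2 (Or.inl h)))

lemma proj_zpt (a b c d : ℂ) (h : ¬(a = 0 ∧ b = 0)) (h' : ¬(c = 0 ∧ d = 0)) :
    proj (zpt a b c d h h') = (cp1 a b h, cp1 c d h') := by
  obtain ⟨u, hu⟩ := Projectivization.exists_smul_eq_mk_rep ℂ ![a, b, c, d] (vec4_ne_zero h)
  refine Prod.ext ?_ ?_
  · refine (Projectivization.mk_eq_mk_iff ℂ _ _ _ _).2 ⟨u, ?_⟩
    simp only [zpt, ← hu]
    ext i
    fin_cases i <;> simp [Units.smul_def]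
  · refine (Projectivization.mk_eq_mk_iff ℂ _ _ _ _).2 ⟨u, ?_⟩
    simp only [zpt, ← hu]
    ext i
    fin_cases i <;> simp [Units.smul_def]

/-- The real submanifold `P_h` of `Z`: the points having homogeneous coordinates with
`z₃ = conj z₀ · e^{-h(z₁/z₀)}` and `z₂ = conj z₁ · e^{-h(z₁/z₀)}`. -/
def realSub (h : S2 → ℝ) : Set Z :=
  {p | ∃ (z₀ z₁ z₂ z₃ : ℂ) (h₁ : ¬(z₀ = 0 ∧ z₁ = 0)) (h₂ : ¬(z₂ = 0 ∧ z₃ = 0)),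
    p = zpt z₀ z₁ z₂ z₃ h₁ h₂ ∧
    z₃ = conj z₀ * (Real.exp (-h (invStereo (cp1 z₀ z₁ h₁))) : ℂ) ∧
    z₂ = conj z₁ * (Real.exp (-h (invStereo (cp1 z₀ z₁ h₁))) : ℂ)}

/-! ### Smooth and holomorphic maps, holomorphic disks -/

/-- The closed unit disk in `ℂ`. -/
abbrev disk : Set ℂ := Metric.closedBall 0 1

/-- Smoothness on a subset `S` of a real manifold for a map to `Z ⊆ ℂP³`: locally the map has
smooth homogeneous coordinates. -/
def SmoothOn {E H M : Type} [NormedAddCommGroup E] [NormedSpace ℝ E] [TopologicalSpace H]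
    (I : ModelWithCorners ℝ E H) [TopologicalSpace M] [ChartedSpace H M]
    (F : M → Z) (S : Set M) : Prop :=
  ∀ x ∈ S, ∃ (U : Set M) (z : M → Fin 4 → ℂ), IsOpen U ∧ x ∈ U ∧
    ContMDiffOn I 𝓘(ℝ, Fin 4 → ℂ) ∞ z (S ∩ U) ∧
    ∀ x' ∈ S ∩ U, ∃ hz : z x' ≠ 0, (F x').1 = Projectivization.mk ℂ (z x') hz

/-- Holomorphy on an open subset `S` of `ℂ` for a map to `Z ⊆ ℂP³`: locally the map has
holomorphic homogeneous coordinates. -/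
def HolomorphicOn (f : ℂ → Z) (S : Set ℂ) : Prop :=
  ∀ x ∈ S, ∃ (U : Set ℂ) (z : ℂ → Fin 4 → ℂ), IsOpen U ∧ x ∈ U ∧
    DifferentiableOn ℂ z (S ∩ U) ∧
    ∀ x' ∈ S ∩ U, ∃ hz : z x' ≠ 0, (f x').1 = Projectivization.mk ℂ (z x') hz

/-- A map of the closed unit disk to `Z` which is smooth up to the boundary and holomorphic in the
interior. -/
def IsDiskMap (f : ℂ → Z) : Prop :=
  SmoothOn 𝓘(ℝ, ℂ) f disk ∧ HolomorphicOn f (Metric.ball 0 1)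

/-- `f` parametrizes the holomorphic disk `D` in `Z`, with boundary on `P`, by the closed unit
disk. -/
structure ParametrizesDisk (P : Set Z) (f : ℂ → Z) (D : Set Z) : Prop where
  isDiskMap : IsDiskMap f
  injOn : Set.InjOn f disk
  image_eq : f '' disk = D
  boundary : ∀ w : ℂ, ‖w‖ = 1 → f w ∈ P

/-- `D` is a holomorphic disk in `Z` with boundary on `P`. -/
def IsHolomorphicDisk (P : Set Z) (D : Set Z) : Prop := ∃ f, ParametrizesDisk P f D

/-- The parameter space `S¹ × ℝ × ℂP¹`, with `ℂP¹` identified with `S²` by stereographic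
projection. -/
abbrev Param : Type := Circle × ℝ × S2

/-- The model with corners of `S¹ × ℝ × S²`. -/
abbrev paramModel := (𝓡 1).prod (𝓘(ℝ, ℝ).prod (𝓡 2))

/-- A smooth family of holomorphic disks in `Z` with boundaries on `P`, indexed by
`S¹ × ℝ × ℂP¹`: locally in the index, the disks are parametrized by the closed unit disk, smoothly
and jointly in the index and the point of the disk. -/
def IsSmoothDiskFamily (P : Set Z) (D : Param → Set Z) : Prop :=
  ∀ m₀ : Param, ∃ (U : Set Param) (F : Param × ℂ → Z), IsOpen U ∧ m₀ ∈ U ∧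
    SmoothOn (paramModel.prod 𝓘(ℝ, ℂ)) F (U ×ˢ disk) ∧
    ∀ m ∈ U, ParametrizesDisk P (fun w => F (m, w)) (D m)

/-! ### The standard disks in `ℂP¹ × ℂP¹` -/

lemma det_aux (a b : ℂ) (h : ¬(a = 0 ∧ b = 0)) : a * conj a + b * conj b ≠ 0 := by
  rw [Complex.mul_conj, Complex.mul_conj]
  norm_cast
  intro h0
  have h1 := Complex.normSq_nonneg a
  have h2 := Complex.normSq_nonneg b
  exact h ⟨Complex.normSq_eq_zero.1 (by linarith), Complex.normSq_eq_zero.1 (by linarith)⟩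

lemma std_ne_zero₁ (t : ℝ) (l : ℂ × ℂ) (h : ¬(l.1 = 0 ∧ l.2 = 0)) (w : ℂ) :
    ¬(conj l.2 * w + l.1 * (Real.exp t : ℂ) = 0 ∧ -conj l.1 * w + l.2 * (Real.exp t : ℂ) = 0) := by
  rintro ⟨h1, h2⟩
  have he : (Real.exp t : ℂ) ≠ 0 := by exact_mod_cast (Real.exp_pos t).ne'
  refine mul_ne_zero (det_aux _ _ h) he ?_
  linear_combination (conj l.1) * h1 + (conj l.2) * h2

lemma std_ne_zero₂ (t : ℝ) (l : ℂ × ℂ) (h : ¬(l.1 = 0 ∧ l.2 = 0)) (w : ℂ) :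
    ¬(-l.1 + conj l.2 * (Real.exp t : ℂ) * w = 0 ∧ l.2 + conj l.1 * (Real.exp t : ℂ) * w = 0) := by
  rintro ⟨h1, h2⟩
  refine det_aux _ _ h ?_
  linear_combination -(conj l.1) * h1 + (conj l.2) * h2

/-- The parametrization of the standard disk over `(t, λ)`. For `λ ≠ ∞` it is
`w ↦ (η₁, η₂) = ((-w + λ eᵗ) / (conj λ w + eᵗ), (λ + eᵗ w) / (-1 + conj λ eᵗ w))`. For `λ = ∞`
(`l = (0, 1)`) it is `w ↦ (eᵗ / w, 1 / (eᵗ w))`, the limit as `λ → ∞` of the former after the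
rotation `w ↦ (λ / conj λ) w` of the disk. -/
def stdMap (t : ℝ) (y : S2) (w : ℂ) : CP1 × CP1 :=
  (cp1 (conj (homCoord y).2 * w + (homCoord y).1 * (Real.exp t : ℂ))
       (-conj (homCoord y).1 * w + (homCoord y).2 * (Real.exp t : ℂ))
       (std_ne_zero₁ t _ (homCoord_ne_zero y) w),
   cp1 (-(homCoord y).1 + conj (homCoord y).2 * (Real.exp t : ℂ) * w)
       ((homCoord y).2 + conj (homCoord y).1 * (Real.exp t : ℂ) * w)
       (std_ne_zero₂ t _ (homCoord_ne_zero y) w))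

/-- The standard disk over `(t, λ)` in `ℂP¹ × ℂP¹`. -/
def stdDisk (t : ℝ) (y : S2) : Set (CP1 × CP1) := stdMap t y '' disk

/-- The (holomorphic) projection maps `D` biholomorphically onto the standard disk over `(t, λ)`:
it is a bijection between them, and its inverse, expressed through the standard parametrization of
the standard disk, is holomorphic (and smooth up to the boundary). -/
def MapsBiholomorphically (D : Set Z) (t : ℝ) (y : S2) : Prop :=
  Set.BijOn proj D (stdDisk t y) ∧
    ∃ g : ℂ → Z, IsDiskMap g ∧ ∀ w ∈ disk, g w ∈ D ∧ proj (g w) = stdMap t y w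

/-! ### The Fourier splitting and the explicit disks -/

/-- The function `H(t, λ; w) = h(η₁(w))`. -/
def bdryFun (h : S2 → ℝ) (t : ℝ) (y : S2) (w : ℂ) : ℝ := h (invStereo (stdMap t y w).1)

/-- The `k`-th Fourier coefficient `H_k(t, λ)` of `H(t, λ; ·)` on the unit circle. -/
def coeff (h : S2 → ℝ) (t : ℝ) (y : S2) (k : ℤ) : ℂ :=
  (2 * Real.pi : ℂ)⁻¹ * ∫ θ in (0 : ℝ)..(2 * Real.pi),
    (bdryFun h t y (Complex.exp (Complex.I * θ)) : ℂ) * Complex.exp (-(Complex.I * k * θ))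

/-- `H₊(t, λ; w) = ∑_{k > 0} H_k wᵏ`. -/
def Hplus (h : S2 → ℝ) (t : ℝ) (y : S2) (w : ℂ) : ℂ :=
  ∑' k : ℕ, coeff h t y ((k : ℤ) + 1) * w ^ (k + 1)

/-- `H₋(t, λ; w) = ∑_{k < 0} H_k wᵏ`. -/
def Hminus (h : S2 → ℝ) (t : ℝ) (y : S2) (w : ℂ) : ℂ :=
  ∑' k : ℕ, coeff h t y (-((k : ℤ) + 1)) * w ^ (-((k : ℤ) + 1))

/-- The factor `-i e^{is} e^{2 H₊ + H₀}`, where `s` stands for `e^{is}` in the unit circle. -/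
def factor (h : S2 → ℝ) (s : Circle) (t : ℝ) (y : S2) (w : ℂ) : ℂ :=
  -Complex.I * (s : ℂ) * Complex.exp (2 * Hplus h t y w + coeff h t y 0)

lemma factor_ne_zero (h : S2 → ℝ) (s : Circle) (t : ℝ) (y : S2) (w : ℂ) :
    factor h s t y w ≠ 0 :=
  mul_ne_zero (mul_ne_zero (neg_ne_zero.2 Complex.I_ne_zero) (Circle.coe_ne_zero s))
    (Complex.exp_ne_zero _)

lemma mul_pair_ne_zero {c a b : ℂ} (hc : c ≠ 0) (h : ¬(a = 0 ∧ b = 0)) :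
    ¬(c * a = 0 ∧ c * b = 0) := by
  rintro ⟨h1, h2⟩
  exact h ⟨(mul_eq_zero.1 h1).resolve_left hc, (mul_eq_zero.1 h2).resolve_left hc⟩

/-- The explicit parametrization
`w ↦ [e^{2H₊ + H₀ + is} Φ : e^{2H₊ + H₀ + is} Φ η₁ : η₂⁻¹ : 1]`, where
`Φ = -i (conj λ w + eᵗ) / (λ + eᵗ w)`, written with the denominators cleared, i.e.
`[-i e^{2H₊ + H₀ + is} (conj λ w + eᵗ) : -i e^{2H₊ + H₀ + is} (-w + λ eᵗ) :
-1 + conj λ eᵗ w : λ + eᵗ w]` when `λ ≠ ∞`. -/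
def explicitMap (h : S2 → ℝ) (s : Circle) (t : ℝ) (y : S2) (w : ℂ) : Z :=
  zpt (factor h s t y w * (conj (homCoord y).2 * w + (homCoord y).1 * (Real.exp t : ℂ)))
      (factor h s t y w * (-conj (homCoord y).1 * w + (homCoord y).2 * (Real.exp t : ℂ)))
      (-(homCoord y).1 + conj (homCoord y).2 * (Real.exp t : ℂ) * w)
      ((homCoord y).2 + conj (homCoord y).1 * (Real.exp t : ℂ) * w)
      (mul_pair_ne_zero (factor_ne_zero h s t y w) (std_ne_zero₁ t _ (homCoord_ne_zero y) w))
      (std_ne_zero₂ t _ (homCoord_ne_zero y) w)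

end TwistorDisks

end

/-! The fibre of π over the point `stdMap t y w` is a copy of ℂ*: its points are the `liftAt f` with
f ≠ 0. For |w| = 1 the equations of `P_h` reduce on this fibre to the single condition |f| = e^H
(`liftAt_mem_realSub_iff`). A holomorphic disk over a standard disk is therefore a nowhere vanishing
function f, holomorphic inside and smooth up to the boundary, with log |f| = H on the circle.

Existence: H is real, so H₋ is the conjugate of H₊ on the circle and Re (2H₊ + H₀) = H there. Hence
e^{2H₊ + H₀} is a solution (`norm_expAt`). Uniqueness: the quotient of two solutions vanishes
nowhere and has modulus one on the circle. The maximum principle for it and for its inverse makes it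
a unit constant (`exists_const_of_norm_eq_one`), and this constant is the freedom in s.

The analytic core is the smoothness of H₊ in (t, λ, w) up to |w| = 1 (`contDiffOn_szego`). The
projection ∑_{k ≥ 0} Â_k wᵏ turns a parameter derivative of A into itself, and turns -i e^{-iθ} ∂_θ
into ∂/∂w. Its derivative is thus built from projections of other smooth functions, and induction on
the order of differentiability applies.

Two further points need care. The coordinates `homCoord` jump at λ = ∞. Rescaling homogeneous
coordinates of λ only rotates the disk, so smooth local coordinates may replace them without
changing any image (`image_explicitMapAt_smul`). For uniqueness of families, w and f are ratios of
linear forms in the homogeneous coordinates of the lift; this recovers s smoothly from a point of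
the disk (`phaseFun`). -/

noncomputable section

namespace TwistorDisks

open Filter Topology MeasureTheory

/-! ### Smoothness up to the boundary of the Szegő projection, with parameters -/

section Szego

set_option linter.unusedSectionVars false

variable {E : Type} [NormedAddCommGroup E] [NormedSpace ℝ E]
variable {F : Type} [NormedAddCommGroup F] [NormedSpace ℝ F] [NormedSpace ℂ F]
  [IsScalarTower ℝ ℂ F]

/-- The unnormalized Fourier coefficients `∫ A(p, θ) e^{-ikθ} dθ` over a period. -/
def circleCoeff (A : E × ℝ → F) (k : ℤ) (p : E) : F :=
  ∫ θ in (0 : ℝ)..(2 * Real.pi), Complex.exp (-(Complex.I * k * θ)) • A (p, θ)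

/-- The Szegő projection `∑_{k ≥ 0} Â_k(p) wᵏ` of a family of functions on the circle. -/
def szego (A : E × ℝ → F) (x : E × ℂ) : F := ∑' n : ℕ, x.2 ^ n • circleCoeff A n x.1

/-- The derivative in the parameter. -/
def paramDeriv (A : E × ℝ → F) (q : E × ℝ) : E →L[ℝ] F :=
  (fderiv ℝ A q).comp (ContinuousLinearMap.inl ℝ E ℝ)

/-- The derivative `-i e^{-iθ} ∂_θ` along the circle, i.e. `∂/∂w` for `w = e^{iθ}`. -/
def circleDeriv (A : E × ℝ → F) (q : E × ℝ) : F :=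
  (-Complex.I * Complex.exp (-(Complex.I * q.2))) • fderiv ℝ A q (0, 1)

lemma contDiff_paramDeriv {A : E × ℝ → F} (hA : ContDiff ℝ ∞ A) : ContDiff ℝ ∞ (paramDeriv A) := by
  have h1 : ContDiff ℝ ∞ (fderiv ℝ A) := hA.fderiv_right (by simp)
  exact h1.clm_comp contDiff_const

lemma contDiff_circleDeriv {A : E × ℝ → F} (hA : ContDiff ℝ ∞ A) :
    ContDiff ℝ ∞ (circleDeriv A) := by
  have h1 : ContDiff ℝ ∞ (fderiv ℝ A) := hA.fderiv_right (by simp)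
  have h2 : ContDiff ℝ ∞ (fun q : E × ℝ => (q.2 : ℂ)) :=
    Complex.ofRealCLM.contDiff.comp contDiff_snd
  have h3 : ContDiff ℝ ∞ (fun q : E × ℝ => -Complex.I * Complex.exp (-(Complex.I * q.2))) :=
    contDiff_const.mul ((contDiff_const.mul h2).neg.cexp)
  exact h3.smul (h1.clm_apply contDiff_const)

/-- Periodicity in the angle. -/
def AnglePeriodic {G : Type} (A : E × ℝ → G) : Prop :=
  ∀ p θ, A (p, θ + 2 * Real.pi) = A (p, θ)

lemma AnglePeriodic.fderiv {A : E × ℝ → F} (hA : AnglePeriodic A) (p : E) (θ : ℝ) :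
    fderiv ℝ A (p, θ + 2 * Real.pi) = fderiv ℝ A (p, θ) := by
  have h : (fun q : E × ℝ => A (q + (0, 2 * Real.pi))) = A := by
    ext ⟨p, θ⟩
    simpa using hA p θ
  have h2 := fderiv_comp_add_right (𝕜 := ℝ) (f := A) (x := (p, θ)) (0, 2 * Real.pi)
  rw [h] at h2
  simpa using h2.symm

lemma exp_period (θ : ℝ) :
    Complex.exp (-(Complex.I * ((θ + 2 * Real.pi : ℝ) : ℂ))) = Complex.exp (-(Complex.I * θ)) := by
  rw [← Complex.exp_periodic (-(Complex.I * ((θ + 2 * Real.pi : ℝ) : ℂ)))]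
  congr 1
  push_cast
  ring

lemma AnglePeriodic.paramDeriv {A : E × ℝ → F} (hA : AnglePeriodic A) :
    AnglePeriodic (paramDeriv A) := fun p θ => by
  simp [TwistorDisks.paramDeriv, hA.fderiv]

lemma AnglePeriodic.circleDeriv {A : E × ℝ → F} (hA : AnglePeriodic A) :
    AnglePeriodic (circleDeriv A) := fun p θ => by
  simp only [TwistorDisks.circleDeriv, hA.fderiv, exp_period]

lemma contDiff_phase (k : ℤ) :
    ContDiff ℝ ∞ (fun θ : ℝ => Complex.exp (-(Complex.I * k * θ))) :=
  ((contDiff_const.mul Complex.ofRealCLM.contDiff).neg).cexp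

lemma norm_phase (k : ℤ) (θ : ℝ) : ‖Complex.exp (-(Complex.I * k * θ))‖ = 1 := by
  rw [Complex.norm_exp]
  simp

lemma phase_two_pi (k : ℤ) : Complex.exp (-(Complex.I * k * ((2 * Real.pi : ℝ) : ℂ))) = 1 := by
  rw [Complex.exp_eq_one_iff]
  refine ⟨-k, ?_⟩
  push_cast
  ring

/-- Integration by parts: the boundary terms cancel by periodicity, and the factor e^{-iθ} in
`circleDeriv` raises the index by one. This is termwise differentiation of ∑ Â_k wᵏ in w. -/
lemma circleCoeff_circleDeriv [CompleteSpace F] {A : E × ℝ → F} (hA : ContDiff ℝ ∞ A)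
    (hp : AnglePeriodic A) (k : ℤ) (p : E) :
    circleCoeff (circleDeriv A) k p = ((k : ℂ) + 1) • circleCoeff A (k + 1) p := by
  have hd : ∀ θ : ℝ, HasDerivAt (fun θ : ℝ => A (p, θ)) (fderiv ℝ A (p, θ) (0, 1)) θ := fun θ =>
    ((hA.differentiable (by simp)).differentiableAt.hasFDerivAt (x := (p, θ))).comp_hasDerivAt θ
      ((hasDerivAt_const θ p).prodMk (hasDerivAt_id θ))
  have he : ∀ θ : ℝ, HasDerivAt (fun θ : ℝ => Complex.exp (-(Complex.I * ((k + 1 : ℤ) : ℂ) * θ)))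
      (Complex.exp (-(Complex.I * ((k + 1 : ℤ) : ℂ) * θ)) * -(Complex.I * ((k + 1 : ℤ) : ℂ))) θ := by
    intro θ
    have := ((Complex.ofRealCLM.hasDerivAt (x := θ)).const_mul
      (Complex.I * ((k + 1 : ℤ) : ℂ))).neg.cexp
    simpa using this
  have hm := fun θ : ℝ => (he θ).fun_smul (hd θ)
  have hcA : Continuous (fun θ : ℝ => A (p, θ)) :=
    hA.continuous.comp (Continuous.prodMk_right p)
  have hcf : Continuous (fun θ : ℝ => fderiv ℝ A (p, θ) (0, 1)) :=
    ((hA.continuous_fderiv (by simp)).comp (Continuous.prodMk_right p)).clm_apply continuous_const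
  have hce := (contDiff_phase (k + 1)).continuous
  have i1 : IntervalIntegrable (fun θ : ℝ => Complex.exp (-(Complex.I * ((k + 1 : ℤ) : ℂ) * θ)) •
      fderiv ℝ A (p, θ) (0, 1)) volume 0 (2 * Real.pi) := (hce.smul hcf).intervalIntegrable _ _
  have i2 : IntervalIntegrable (fun θ : ℝ => (Complex.exp (-(Complex.I * ((k + 1 : ℤ) : ℂ) * θ)) *
      -(Complex.I * ((k + 1 : ℤ) : ℂ))) • A (p, θ)) volume 0 (2 * Real.pi) :=
    ((hce.mul continuous_const).smul hcA).intervalIntegrable _ _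
  have key := intervalIntegral.integral_eq_sub_of_hasDerivAt (a := 0) (b := 2 * Real.pi)
    (fun θ _ => hm θ) (i1.add i2)
  have h0 : A (p, 2 * Real.pi) = A (p, 0) := by simpa using hp p 0
  rw [phase_two_pi, h0, intervalIntegral.integral_add i1 i2] at key
  have key2 : (∫ θ in (0 : ℝ)..(2 * Real.pi),
      Complex.exp (-(Complex.I * ((k + 1 : ℤ) : ℂ) * θ)) • fderiv ℝ A (p, θ) (0, 1)) =
      (Complex.I * ((k + 1 : ℤ) : ℂ)) • circleCoeff A (k + 1) p := by
    rw [circleCoeff, ← intervalIntegral.integral_smul]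
    have : ∀ a b : F, a + b = 0 → a = -b := fun a b h => eq_neg_of_add_eq_zero_left h
    rw [this _ _ (key.trans (by simp)), ← intervalIntegral.integral_neg]
    congr 1
    ext θ
    rw [smul_smul, ← neg_smul]
    congr 1
    ring
  have h3 : circleCoeff (circleDeriv A) k p = (-Complex.I) • ∫ θ in (0 : ℝ)..(2 * Real.pi),
      Complex.exp (-(Complex.I * ((k + 1 : ℤ) : ℂ) * θ)) • fderiv ℝ A (p, θ) (0, 1) := by
    rw [circleCoeff, ← intervalIntegral.integral_smul]
    congr 1
    ext θ
    simp only [circleDeriv, smul_smul]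
    congr 1
    have : Complex.exp (-(Complex.I * ((k + 1 : ℤ) : ℂ) * θ)) =
        Complex.exp (-(Complex.I * k * θ)) * Complex.exp (-(Complex.I * θ)) := by
      rw [← Complex.exp_add]
      congr 1
      push_cast
      ring
    rw [this]
    ring
  rw [h3, key2, smul_smul]
  congr 1
  push_cast
  linear_combination (-(k : ℂ) - 1) * Complex.I_mul_I

variable [FiniteDimensional ℝ E]

lemma exists_bound {A : E × ℝ → F} (hA : Continuous A) (p₀ : E) :
    ∃ C, 0 ≤ C ∧ ∀ p ∈ Metric.closedBall p₀ 1, ∀ θ ∈ Set.Icc 0 (2 * Real.pi), ‖A (p, θ)‖ ≤ C := by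
  have : ProperSpace E := FiniteDimensional.proper ℝ E
  obtain ⟨C, hC⟩ := ((isCompact_closedBall p₀ 1).prod
    (isCompact_Icc (a := (0 : ℝ)) (b := 2 * Real.pi))).exists_bound_of_continuousOn hA.continuousOn
  refine ⟨max C 0, le_max_right _ _, fun p hp θ hθ => (hC (p, θ) ⟨hp, hθ⟩).trans (le_max_left _ _)⟩

lemma exists_circleCoeff_bound {A : E × ℝ → F} (hA : Continuous A) (p₀ : E) :
    ∃ C, 0 ≤ C ∧ ∀ (k : ℤ), ∀ p ∈ Metric.closedBall p₀ 1, ‖circleCoeff A k p‖ ≤ C := by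
  obtain ⟨C, hC0, hC⟩ := exists_bound hA p₀
  refine ⟨C * |2 * Real.pi - 0|, by positivity, fun k p hp => ?_⟩
  refine intervalIntegral.norm_integral_le_of_norm_le_const fun θ hθ => ?_
  rw [norm_smul, norm_phase, one_mul]
  rw [Set.uIoc_of_le (by positivity)] at hθ
  exact hC p hp θ ⟨hθ.1.le, hθ.2⟩

lemma summable_inv_one_add_sq : Summable (fun k : ℤ => (1 + (k : ℝ) ^ 2)⁻¹) := by
  refine Summable.of_norm_bounded_eventually
    ((Real.summable_one_div_int_pow (p := 2)).2 one_lt_two) ?_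
  have : ∀ᶠ k : ℤ in cofinite, k ≠ 0 := (Set.finite_singleton 0).compl_mem_cofinite
  filter_upwards [this] with k hk
  have hk' : (0 : ℝ) < (k : ℝ) ^ 2 := by positivity
  rw [Real.norm_of_nonneg (by positivity), one_div]
  exact inv_anti₀ hk' (by linarith)

/-- Applying `circleDeriv` twice multiplies Â_k by k(k - 1) and leaves a bounded coefficient, so Â_k
decays quadratically, uniformly for p in a ball. -/
lemma exists_circleCoeff_summable_bound [CompleteSpace F] {A : E × ℝ → F} (hA : ContDiff ℝ ∞ A)
    (hp : AnglePeriodic A) (p₀ : E) :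
    ∃ u : ℤ → ℝ, Summable u ∧ ∀ k, ∀ p ∈ Metric.closedBall p₀ 1, ‖circleCoeff A k p‖ ≤ u k := by
  obtain ⟨C, hC0, hC⟩ := exists_circleCoeff_bound hA.continuous p₀
  obtain ⟨C', hC0', hC'⟩ := exists_circleCoeff_bound
    (contDiff_circleDeriv (contDiff_circleDeriv hA)).continuous p₀
  -- The constant comes from 1 + k² ≤ 2 + 2k(k - 1), where the difference of the two sides is (k -
  -- 1)².
  refine ⟨fun k => (2 * (C + C')) * (1 + (k : ℝ) ^ 2)⁻¹, summable_inv_one_add_sq.mul_left _, ?_⟩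
  intro k p hpp
  have h1 := hC k p hpp
  have h2 := hC' (k - 2) p hpp
  rw [circleCoeff_circleDeriv (contDiff_circleDeriv hA) hp.circleDeriv,
    circleCoeff_circleDeriv hA hp, smul_smul, norm_smul,
    show k - 2 + 1 + 1 = k by ring] at h2
  have h3 : ‖(((k - 2 : ℤ) : ℂ) + 1) * (((k - 2 + 1 : ℤ) : ℂ) + 1)‖ = |((k : ℝ) - 1) * k| := by
    rw [← Real.norm_eq_abs, ← Complex.norm_real]
    congr 1
    push_cast
    ring
  rw [h3] at h2
  have h4 : ((k : ℝ) - 1) * k ≤ |((k : ℝ) - 1) * k| := le_abs_self _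
  have h5 : 0 ≤ ‖circleCoeff A k p‖ := norm_nonneg _
  change _ ≤ _ * _
  rw [← div_eq_mul_inv, le_div_iff₀ (by positivity)]
  nlinarith [mul_le_mul_of_nonneg_right h4 h5, mul_nonneg h5 (sq_nonneg ((k : ℝ) - 1))]

lemma hasFDerivAt_circleCoeff [CompleteSpace F] {A : E × ℝ → F} (hA : ContDiff ℝ ∞ A) (k : ℤ)
    (p : E) : HasFDerivAt (circleCoeff A k) (circleCoeff (paramDeriv A) k p) p := by
  obtain ⟨C, hC0, hC⟩ := exists_bound (contDiff_paramDeriv hA).continuous p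
  have hc : ∀ {G : Type} [NormedAddCommGroup G] [NormedSpace ℂ G] (B : E × ℝ → G)
      (_ : Continuous B) (p : E),
      Continuous (fun θ : ℝ => Complex.exp (-(Complex.I * k * θ)) • B (p, θ)) :=
    fun B hB p => (contDiff_phase k).continuous.smul (hB.comp (Continuous.prodMk_right p))
  refine intervalIntegral.hasFDerivAt_integral_of_dominated_of_fderiv_le
    (F' := fun p θ => Complex.exp (-(Complex.I * k * θ)) • paramDeriv A (p, θ))
    (bound := fun _ => C) (Metric.ball_mem_nhds p one_pos)
    (Eventually.of_forall fun p => (hc A hA.continuous p).aestronglyMeasurable)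
    ((hc A hA.continuous p).intervalIntegrable _ _)
    (hc _ (contDiff_paramDeriv hA).continuous p).aestronglyMeasurable
    (Eventually.of_forall fun θ hθ x hx => ?_) (by simp)
    (Eventually.of_forall fun θ hθ x hx => ?_)
  · rw [norm_smul, norm_phase, one_mul]
    rw [Set.uIoc_of_le (by positivity)] at hθ
    exact hC x (Metric.ball_subset_closedBall hx) θ ⟨hθ.1.le, hθ.2⟩
  · refine HasFDerivAt.fun_const_smul ?_ _
    exact ((hA.differentiable (by simp)).differentiableAt.hasFDerivAt (x := (x, θ))).comp x
      ((hasFDerivAt_id x).prodMk (hasFDerivAt_const θ x))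

lemma norm_pow_le_one {w : ℂ} (hw : ‖w‖ ≤ 1) (n : ℕ) : ‖w ^ n‖ ≤ 1 := by
  rw [norm_pow]
  exact pow_le_one₀ (norm_nonneg _) hw

lemma continuousOn_szego [CompleteSpace F] {A : E × ℝ → F} (hA : ContDiff ℝ ∞ A)
    (hp : AnglePeriodic A) : ContinuousOn (szego A) (Set.univ ×ˢ disk) := by
  rintro ⟨p, w⟩ ⟨-, hw⟩
  obtain ⟨u, hu, hb⟩ := exists_circleCoeff_summable_bound hA hp p
  have h : ContinuousOn (szego A) (Metric.closedBall p 1 ×ˢ disk) := by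
    refine continuousOn_tsum (u := fun n : ℕ => u n) (fun n => ?_)
      (hu.comp_injective Nat.cast_injective) fun n x hx => ?_
    · have h1 : Continuous (circleCoeff A n) :=
        continuous_iff_continuousAt.2 fun p => (hasFDerivAt_circleCoeff hA n p).continuousAt
      exact ((continuous_snd.pow n).smul (h1.comp continuous_fst)).continuousOn
    · rw [norm_smul]
      have h1 := norm_pow_le_one (mem_closedBall_zero_iff.1 hx.2) n
      have h2 := hb n x.1 hx.1
      have h3 := norm_nonneg (circleCoeff A n x.1)
      nlinarith [norm_nonneg (x.2 ^ n)]
  refine (h (p, w) ⟨Metric.mem_closedBall_self zero_le_one, hw⟩).mono_of_mem_nhdsWithin ?_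
  rw [mem_nhdsWithin]
  refine ⟨Metric.ball p 1 ×ˢ Set.univ, Metric.isOpen_ball.prod isOpen_univ,
    ⟨Metric.mem_ball_self one_pos, trivial⟩, ?_⟩
  rintro ⟨a, b⟩ ⟨⟨h1, -⟩, -, h2⟩
  exact ⟨Metric.ball_subset_closedBall h1, h2⟩

/-- The derivative of `szego A`. -/
def szegoDeriv (A : E × ℝ → F) (x : E × ℂ) : E × ℂ →L[ℝ] F :=
  (szego (paramDeriv A) x).comp (ContinuousLinearMap.fst ℝ E ℂ) +
    ((ContinuousLinearMap.lsmul ℝ ℂ : ℂ →L[ℝ] F →L[ℝ] F).flip (szego (circleDeriv A) x)).comp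
      (ContinuousLinearMap.snd ℝ E ℂ)

lemma summable_szego [CompleteSpace F] {A : E × ℝ → F} (hA : ContDiff ℝ ∞ A)
    (hp : AnglePeriodic A) (x : E × ℂ) (hx : ‖x.2‖ ≤ 1) :
    Summable (fun n : ℕ => x.2 ^ n • circleCoeff A n x.1) := by
  obtain ⟨u, hu, hb⟩ := exists_circleCoeff_summable_bound hA hp x.1
  refine Summable.of_norm_bounded (hu.comp_injective (Nat.cast_injective (R := ℤ))) fun n => ?_
  rw [norm_smul]
  have h1 := norm_pow_le_one hx n
  have h2 := hb n x.1 (Metric.mem_closedBall_self zero_le_one)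
  have h3 := norm_nonneg (circleCoeff A n x.1)
  simp only [Function.comp]
  nlinarith [norm_nonneg (x.2 ^ n)]

/-- Termwise differentiation. The w-derivative of the n-th term involves n Â_n, which is the
coefficient of index n - 1 of `circleDeriv A`, so the summable bounds for `paramDeriv A` and
`circleDeriv A` dominate the series of derivatives. -/
lemma hasFDerivAt_szego [CompleteSpace F] {A : E × ℝ → F} (hA : ContDiff ℝ ∞ A)
    (hp : AnglePeriodic A) (x : E × ℂ) (hx : ‖x.2‖ < 1) :
    HasFDerivAt (szego A) (szegoDeriv A x) x := by
  obtain ⟨u, hu, hub⟩ := exists_circleCoeff_summable_bound (contDiff_paramDeriv hA)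
    hp.paramDeriv x.1
  obtain ⟨v, hv, hvb⟩ := exists_circleCoeff_summable_bound (contDiff_circleDeriv hA)
    hp.circleDeriv x.1
  have hterm : ∀ (n : ℕ) (q : E × ℂ), HasFDerivAt
      (fun q : E × ℂ => q.2 ^ n • circleCoeff A n q.1)
      (q.2 ^ n • (circleCoeff (paramDeriv A) n q.1).comp (ContinuousLinearMap.fst ℝ E ℂ) +
        ((ContinuousLinearMap.lsmul ℝ ℂ : ℂ →L[ℝ] F →L[ℝ] F).flip
          (((n : ℂ) * q.2 ^ (n - 1)) • circleCoeff A n q.1)).comp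
          (ContinuousLinearMap.snd ℝ E ℂ)) q := by
    intro n q
    have h1 : HasFDerivAt (fun q : E × ℂ => circleCoeff A n q.1)
        ((circleCoeff (paramDeriv A) n q.1).comp (ContinuousLinearMap.fst ℝ E ℂ)) q :=
      (hasFDerivAt_circleCoeff hA n q.1).comp q hasFDerivAt_fst
    have h2 : HasFDerivAt (fun q : E × ℂ => q.2 ^ n)
        (((n : ℂ) * q.2 ^ (n - 1)) • ContinuousLinearMap.snd ℝ E ℂ) q := by
      have := (hasDerivAt_pow n q.2).complexToReal_fderiv.comp q
        (hasFDerivAt_snd (𝕜 := ℝ) (E := E) (F := ℂ) (p := q))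
      refine this.congr_fderiv ?_
      ext <;> simp
    refine (h2.fun_smul h1).congr_fderiv ?_
    ext y <;> simp [smul_smul, mul_comm]
  have hsum := hasFDerivAt_tsum_of_isPreconnected (𝕜 := ℝ)
    (s := Metric.ball x.1 1 ×ˢ Metric.ball (0 : ℂ) 1)
    -- The index n - 1 is an integer; for n = 0 it is -1, where `v` is still a valid bound.
    (u := fun n : ℕ => u n + v (n - 1))
    ((hu.comp_injective (Nat.cast_injective (R := ℤ))).add
      (hv.comp_injective (i := fun n : ℕ => (n : ℤ) - 1) (fun a b h => by simpa using h)))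
    (Metric.isOpen_ball.prod Metric.isOpen_ball)
    ((convex_ball _ _).prod (convex_ball _ _)).isPreconnected
    (fun n q _ => hterm n q) (fun n q hq => ?_) (x₀ := x)
    ⟨Metric.mem_ball_self one_pos, mem_ball_zero_iff.2 hx⟩ (summable_szego hA hp x hx.le)
    (x := x) ⟨Metric.mem_ball_self one_pos, mem_ball_zero_iff.2 hx⟩
  · refine hsum.congr_fderiv ?_
    have h1 : HasSum (fun n : ℕ => x.2 ^ n • circleCoeff (paramDeriv A) n x.1)
        (szego (paramDeriv A) x) :=
      (summable_szego (contDiff_paramDeriv hA) hp.paramDeriv x hx.le).hasSum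
    have h2 : HasSum (fun n : ℕ => x.2 ^ n • circleCoeff (circleDeriv A) n x.1)
        (szego (circleDeriv A) x) :=
      (summable_szego (contDiff_circleDeriv hA) hp.circleDeriv x hx.le).hasSum
    have h3 : HasSum (fun n : ℕ => ((n : ℂ) * x.2 ^ (n - 1)) • circleCoeff A n x.1)
        (szego (circleDeriv A) x) := by
      -- The term n = 0 vanishes, and dropping it matches the shift of index in
      -- `circleCoeff_circleDeriv`.
      rw [← hasSum_nat_add_iff' 1]
      simp only [Finset.range_one, Finset.sum_singleton, Nat.cast_zero, zero_mul, zero_smul,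
        sub_zero, Nat.add_sub_cancel]
      convert h2 using 2 with n
      rw [circleCoeff_circleDeriv hA hp, smul_smul]
      push_cast
      rw [mul_comm]
    have h4 := h1.mapL ((ContinuousLinearMap.compL ℝ (E × ℂ) E F).flip
      (ContinuousLinearMap.fst ℝ E ℂ))
    have h5 := h3.mapL (((ContinuousLinearMap.compL ℝ (E × ℂ) ℂ F).flip
      (ContinuousLinearMap.snd ℝ E ℂ)).comp (ContinuousLinearMap.lsmul ℝ ℂ).flip)
    exact (h4.add h5).tsum_eq
  · have hq2 := (mem_ball_zero_iff.1 hq.2).le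
    have b1 := hub n q.1 (Metric.ball_subset_closedBall hq.1)
    have b2 := hvb ((n : ℤ) - 1) q.1 (Metric.ball_subset_closedBall hq.1)
    rw [circleCoeff_circleDeriv hA hp, sub_add_cancel, norm_smul] at b2
    have b3 : ‖(((n : ℤ) - 1 : ℤ) : ℂ) + 1‖ = n := by simp
    rw [b3] at b2
    have hu0 : 0 ≤ u n := (norm_nonneg _).trans b1
    have hv0 : 0 ≤ v (n - 1) := le_trans (by positivity) b2
    refine ContinuousLinearMap.opNorm_le_bound _ (by positivity) fun y => ?_
    have e1 : ‖q.2 ^ n • circleCoeff (paramDeriv A) n q.1 y.1‖ ≤ u n * ‖y‖ := by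
      rw [norm_smul, ← one_mul (u n * ‖y‖)]
      refine mul_le_mul (norm_pow_le_one hq2 n) ?_ (norm_nonneg _) zero_le_one
      exact (ContinuousLinearMap.le_opNorm _ _).trans
        (mul_le_mul b1 (norm_fst_le y) (norm_nonneg _) hu0)
    have e2 : ‖y.2 • (((n : ℂ) * q.2 ^ (n - 1)) • circleCoeff A n q.1)‖ ≤ v (n - 1) * ‖y‖ := by
      rw [norm_smul, norm_smul, norm_mul, Complex.norm_natCast, mul_comm]
      refine mul_le_mul ?_ (norm_snd_le y) (norm_nonneg _) hv0
      refine le_trans ?_ b2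
      have := norm_pow_le_one hq2 (n - 1)
      gcongr
      exact mul_le_of_le_one_right (Nat.cast_nonneg _) this
    rw [add_mul]
    exact (norm_add_le _ _).trans (add_le_add e1 e2)

lemma continuousOn_szegoDeriv [CompleteSpace F] {A : E × ℝ → F} (hA : ContDiff ℝ ∞ A)
    (hp : AnglePeriodic A) : ContinuousOn (szegoDeriv A) (Set.univ ×ˢ disk) := by
  have h1 := continuousOn_szego (contDiff_paramDeriv hA) hp.paramDeriv
  have h2 := continuousOn_szego (contDiff_circleDeriv hA) hp.circleDeriv
  refine (h1.clm_comp continuousOn_const).add (ContinuousOn.clm_comp ?_ continuousOn_const)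
  exact (ContinuousLinearMap.continuous _).comp_continuousOn h2

/-- On the convex open set where |w| < 1 the derivative is known. It extends continuously to the
closure, which gives differentiability within the closed set at boundary points too. -/
lemma hasFDerivWithinAt_szego [CompleteSpace F] {A : E × ℝ → F} (hA : ContDiff ℝ ∞ A)
    (hp : AnglePeriodic A) (x : E × ℂ) (hx : x ∈ (Set.univ : Set E) ×ˢ disk) :
    HasFDerivWithinAt (szego A) (szegoDeriv A x) (Set.univ ×ˢ disk) x := by
  have hcl : closure ((Set.univ : Set E) ×ˢ Metric.ball (0 : ℂ) 1) = Set.univ ×ˢ disk := by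
    rw [closure_prod_eq, closure_univ, closure_ball _ one_ne_zero]
  have hsub : (Set.univ : Set E) ×ˢ Metric.ball (0 : ℂ) 1 ⊆ Set.univ ×ˢ disk :=
    Set.prod_mono le_rfl Metric.ball_subset_closedBall
  rw [← hcl]
  refine hasFDerivWithinAt_closure_of_tendsto_fderiv
    (fun y hy => (hasFDerivAt_szego hA hp y
      (mem_ball_zero_iff.1 hy.2)).differentiableAt.differentiableWithinAt)
    (convex_univ.prod (convex_ball _ _)) (isOpen_univ.prod Metric.isOpen_ball)
    (fun y hy => ((continuousOn_szego hA hp) y (hcl ▸ hy)).mono hsub) ?_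
  refine (((continuousOn_szegoDeriv hA hp) x hx).mono hsub).tendsto.congr' ?_
  filter_upwards [self_mem_nhdsWithin] with y hy
  exact (hasFDerivAt_szego hA hp y (mem_ball_zero_iff.1 hy.2)).fderiv.symm

end Szego

/-- The target F is quantified inside the induction because `paramDeriv A` takes values in `E →L[ℝ]
F`. -/
lemma contDiffOn_szego_nat {E : Type} [NormedAddCommGroup E] [NormedSpace ℝ E]
    [FiniteDimensional ℝ E] (n : ℕ) :
    ∀ {F : Type} [NormedAddCommGroup F] [NormedSpace ℝ F] [NormedSpace ℂ F]
      [IsScalarTower ℝ ℂ F] [CompleteSpace F] {A : E × ℝ → F} (_ : ContDiff ℝ ∞ A)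
      (_ : AnglePeriodic A), ContDiffOn ℝ n (szego A) (Set.univ ×ˢ disk) := by
  induction n with
  | zero =>
    intro F _ _ _ _ _ A hA hp
    exact contDiffOn_zero.2 (continuousOn_szego hA hp)
  | succ n ih =>
    intro F _ _ _ _ _ A hA hp
    have hu : UniqueDiffOn ℝ ((Set.univ : Set E) ×ˢ disk) :=
      uniqueDiffOn_univ.prod (uniqueDiffOn_convex (convex_closedBall _ _)
        ⟨0, by rw [interior_closedBall _ one_ne_zero]; simp⟩)
    rw [Nat.cast_succ, contDiffOn_succ_iff_hasFDerivWithinAt_of_uniqueDiffOn hu]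
    refine ⟨by simp, szegoDeriv A, ?_, hasFDerivWithinAt_szego hA hp⟩
    have h1 := ih (contDiff_paramDeriv hA) hp.paramDeriv
    have h2 := ih (contDiff_circleDeriv hA) hp.circleDeriv
    refine (h1.clm_comp contDiffOn_const).add (ContDiffOn.clm_comp ?_ contDiffOn_const)
    exact (ContinuousLinearMap.contDiff _).comp_contDiffOn h2

lemma contDiffOn_szego {E : Type} [NormedAddCommGroup E] [NormedSpace ℝ E]
    [FiniteDimensional ℝ E] {F : Type} [NormedAddCommGroup F] [NormedSpace ℝ F] [NormedSpace ℂ F]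
    [IsScalarTower ℝ ℂ F] [CompleteSpace F] {A : E × ℝ → F} (hA : ContDiff ℝ ∞ A)
    (hp : AnglePeriodic A) : ContDiffOn ℝ ∞ (szego A) (Set.univ ×ˢ disk) :=
  contDiffOn_infty.2 fun n => contDiffOn_szego_nat n hA hp

/-! ### Pointwise convergence of the Fourier series -/

lemma exp_I_mul_zpow (θ : ℝ) (k : ℤ) :
    Complex.exp (Complex.I * θ) ^ k = Complex.exp (Complex.I * k * θ) := by
  rw [← Complex.exp_int_mul]
  congr 1
  ring

lemma exists_exp_of_norm_eq_one {w : ℂ} (hw : ‖w‖ = 1) : ∃ θ : ℝ, w = Complex.exp (Complex.I * θ) := by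
  refine ⟨Complex.arg w, ?_⟩
  have := Complex.norm_mul_exp_arg_mul_I w
  rw [hw, Complex.ofReal_one, one_mul] at this
  rw [mul_comm, this]

/-- The function descends to a continuous function on `AddCircle (2 * Real.pi)` with summable
Fourier coefficients, so its Fourier series converges to it at every point. -/
lemma hasSum_circleCoeff {E : Type} [NormedAddCommGroup E] [NormedSpace ℝ E]
    [FiniteDimensional ℝ E] {A : E × ℝ → ℂ} (hA : ContDiff ℝ ∞ A) (hp : AnglePeriodic A) (p : E)
    (θ : ℝ) : HasSum (fun k : ℤ => (2 * Real.pi : ℂ)⁻¹ * circleCoeff A k p *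
      Complex.exp (Complex.I * θ) ^ k) (A (p, θ)) := by
  have hT : Fact (0 < 2 * Real.pi) := ⟨Real.two_pi_pos⟩
  have hper : Function.Periodic (fun θ : ℝ => A (p, θ)) (2 * Real.pi) := fun θ => hp p θ
  let f : C(AddCircle (2 * Real.pi), ℂ) := ⟨hper.lift, continuous_coinduced_dom.2
    (hA.continuous.comp (Continuous.prodMk_right p))⟩
  have hf : ∀ θ : ℝ, f (θ : AddCircle (2 * Real.pi)) = A (p, θ) := fun θ => rfl
  have hcoe : ∀ (k : ℤ) (θ : ℝ), fourier k (θ : AddCircle (2 * Real.pi)) =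
      Complex.exp (Complex.I * k * θ) := by
    intro k θ
    rw [fourier_coe_apply]
    congr 1
    have : (Real.pi : ℂ) ≠ 0 := by exact_mod_cast Real.pi_ne_zero
    push_cast
    field_simp
  have hc : ∀ k : ℤ, fourierCoeff f k = (2 * Real.pi : ℂ)⁻¹ * circleCoeff A k p := by
    intro k
    rw [fourierCoeff_eq_intervalIntegral f k 0, zero_add, circleCoeff, Complex.real_smul]
    push_cast
    rw [one_div]
    congr 1
    refine intervalIntegral.integral_congr fun x _ => ?_
    simp only [hcoe, hf]
    congr 2
    push_cast
    ring
  obtain ⟨u, hu, hb⟩ := exists_circleCoeff_summable_bound hA hp p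
  have hs : Summable (fourierCoeff f) := by
    rw [funext hc]
    exact (Summable.of_norm_bounded hu
      fun k => hb k p (Metric.mem_closedBall_self zero_le_one)).mul_left _
  have := has_pointwise_sum_fourier_series_of_summable hs (θ : AddCircle (2 * Real.pi))
  rw [hf] at this
  convert this using 2 with k
  rw [hc, hcoe, smul_eq_mul, exp_I_mul_zpow]

/-! ### The standard and the explicit disks in terms of arbitrary homogeneous coordinates of `λ` -/

/-- `l` is a pair of homogeneous coordinates. -/
abbrev Nonzero (l : ℂ × ℂ) : Prop := ¬(l.1 = 0 ∧ l.2 = 0)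

/-- `stdMap` for homogeneous coordinates `l` of `λ`. -/
def stdMapAt (t : ℝ) (l : ℂ × ℂ) (hl : Nonzero l) (w : ℂ) : CP1 × CP1 :=
  (cp1 (conj l.2 * w + l.1 * (Real.exp t : ℂ)) (-conj l.1 * w + l.2 * (Real.exp t : ℂ))
    (std_ne_zero₁ t l hl w),
   cp1 (-l.1 + conj l.2 * (Real.exp t : ℂ) * w) (l.2 + conj l.1 * (Real.exp t : ℂ) * w)
    (std_ne_zero₂ t l hl w))

/-- `bdryFun` for homogeneous coordinates `l` of `λ`. -/
def bdryFunAt (h : S2 → ℝ) (t : ℝ) (l : ℂ × ℂ) (hl : Nonzero l) (w : ℂ) : ℝ :=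
  h (invStereo (stdMapAt t l hl w).1)

/-- `coeff` for homogeneous coordinates `l` of `λ`. -/
def coeffAt (h : S2 → ℝ) (t : ℝ) (l : ℂ × ℂ) (hl : Nonzero l) (k : ℤ) : ℂ :=
  (2 * Real.pi : ℂ)⁻¹ * ∫ θ in (0 : ℝ)..(2 * Real.pi),
    (bdryFunAt h t l hl (Complex.exp (Complex.I * θ)) : ℂ) * Complex.exp (-(Complex.I * k * θ))

/-- `Hplus` for homogeneous coordinates `l` of `λ`. -/
def HplusAt (h : S2 → ℝ) (t : ℝ) (l : ℂ × ℂ) (hl : Nonzero l) (w : ℂ) : ℂ :=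
  ∑' k : ℕ, coeffAt h t l hl ((k : ℤ) + 1) * w ^ (k + 1)

/-- `e^{2 H₊ + H₀}` for homogeneous coordinates `l` of `λ`. -/
def expAt (h : S2 → ℝ) (t : ℝ) (l : ℂ × ℂ) (hl : Nonzero l) (w : ℂ) : ℂ :=
  Complex.exp (2 * HplusAt h t l hl w + coeffAt h t l hl 0)

/-- `factor` for homogeneous coordinates `l` of `λ`. -/
def factorAt (h : S2 → ℝ) (s : Circle) (t : ℝ) (l : ℂ × ℂ) (hl : Nonzero l) (w : ℂ) : ℂ :=
  -Complex.I * (s : ℂ) * expAt h t l hl w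

lemma factorAt_ne_zero (h : S2 → ℝ) (s : Circle) (t : ℝ) (l : ℂ × ℂ) (hl : Nonzero l) (w : ℂ) :
    factorAt h s t l hl w ≠ 0 :=
  mul_ne_zero (mul_ne_zero (neg_ne_zero.2 Complex.I_ne_zero) (Circle.coe_ne_zero s))
    (Complex.exp_ne_zero _)

/-- The homogeneous coordinates of the lift of `stdMapAt t l hl w` with factor `f`. -/
def liftVec (f : ℂ) (t : ℝ) (l : ℂ × ℂ) (w : ℂ) : Fin 4 → ℂ :=
  ![f * (conj l.2 * w + l.1 * (Real.exp t : ℂ)), f * (-conj l.1 * w + l.2 * (Real.exp t : ℂ)),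
    -l.1 + conj l.2 * (Real.exp t : ℂ) * w, l.2 + conj l.1 * (Real.exp t : ℂ) * w]

/-- `explicitMap` for homogeneous coordinates `l` of `λ`. -/
def explicitMapAt (h : S2 → ℝ) (s : Circle) (t : ℝ) (l : ℂ × ℂ) (hl : Nonzero l) (w : ℂ) : Z :=
  zpt (factorAt h s t l hl w * (conj l.2 * w + l.1 * (Real.exp t : ℂ)))
    (factorAt h s t l hl w * (-conj l.1 * w + l.2 * (Real.exp t : ℂ)))
    (-l.1 + conj l.2 * (Real.exp t : ℂ) * w) (l.2 + conj l.1 * (Real.exp t : ℂ) * w)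
    (mul_pair_ne_zero (factorAt_ne_zero h s t l hl w) (std_ne_zero₁ t l hl w))
    (std_ne_zero₂ t l hl w)

lemma explicitMap_eq (h : S2 → ℝ) (s : Circle) (t : ℝ) (y : S2) :
    explicitMap h s t y = explicitMapAt h s t (homCoord y) (homCoord_ne_zero y) := rfl

lemma cp1_smul {c a b : ℂ} (hc : c ≠ 0) (h : ¬(a = 0 ∧ b = 0)) {a' b' : ℂ} (ha : a' = c * a)
    (hb : b' = c * b) (h' : ¬(a' = 0 ∧ b' = 0)) : cp1 a' b' h' = cp1 a b h := by
  refine (Projectivization.mk_eq_mk_iff' ℂ _ _ _ _).2 ⟨c, ?_⟩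
  ext i
  fin_cases i <;> simp [ha, hb]

lemma Nonzero.smul {c : ℂ} (hc : c ≠ 0) {l : ℂ × ℂ} (hl : Nonzero l) :
    Nonzero (c * l.1, c * l.2) := mul_pair_ne_zero hc hl

/-! ### Rescaling the homogeneous coordinates of λ rotates the disk -/

section Rotation

variable {c : ℂ} (hc : c ≠ 0) (h : S2 → ℝ) (s : Circle) (t : ℝ) (l : ℂ × ℂ) (hl : Nonzero l)

/-- Conjugated coordinates pick up conj c and the others pick up c. After extracting the common
factor c, only w is affected, by the unit number conj c / c. -/
lemma bdryFunAt_smul (w : ℂ) :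
    bdryFunAt h t (c * l.1, c * l.2) (hl.smul hc) w = bdryFunAt h t l hl (conj c / c * w) := by
  unfold bdryFunAt stdMapAt
  congr 2
  exact cp1_smul hc (std_ne_zero₁ t l hl _) (by simp only [map_mul]; field_simp)
    (by simp only [map_mul]; field_simp) (std_ne_zero₁ t _ (hl.smul hc) _)

include hc in
lemma norm_conj_div : ‖conj c / c‖ = 1 := by
  rw [norm_div, RCLike.norm_conj, div_self (norm_ne_zero_iff.2 hc)]

/-- The rotation is a translation θ ↦ θ + α, and the integral of a periodic function over a period
is translation invariant. -/
lemma coeffAt_smul (k : ℤ) : coeffAt h t (c * l.1, c * l.2) (hl.smul hc) k =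
    coeffAt h t l hl k * (conj c / c) ^ k := by
  obtain ⟨α, hα⟩ := exists_exp_of_norm_eq_one (norm_conj_div hc)
  let g : ℝ → ℂ := fun θ => (bdryFunAt h t l hl (Complex.exp (Complex.I * θ)) : ℂ) *
    Complex.exp (-(Complex.I * k * θ))
  have hg : Function.Periodic g (2 * Real.pi) := by
    intro θ
    have e1 : Complex.exp (Complex.I * ((θ + 2 * Real.pi : ℝ) : ℂ)) =
        Complex.exp (Complex.I * θ) := by
      rw [← Complex.exp_periodic (Complex.I * θ)]
      congr 1
      push_cast
      ring
    have e2 : Complex.exp (-(Complex.I * k * ((θ + 2 * Real.pi : ℝ) : ℂ))) =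
        Complex.exp (-(Complex.I * k * θ)) := by
      rw [Complex.exp_eq_exp_iff_exists_int]
      exact ⟨-k, by push_cast; ring⟩
    simp only [g, e1, e2]
  have h1 : (∫ θ in (0 : ℝ)..(2 * Real.pi), g (θ + α)) = ∫ θ in (0 : ℝ)..(2 * Real.pi), g θ := by
    rw [intervalIntegral.integral_comp_add_right, zero_add, add_comm (2 * Real.pi) α,
      hg.intervalIntegral_add_eq α 0, zero_add]
  unfold coeffAt
  rw [mul_assoc, ← h1, ← intervalIntegral.integral_mul_const]
  congr 1
  refine intervalIntegral.integral_congr fun θ _ => ?_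
  simp only [g]
  have e1 : conj c / c * Complex.exp (Complex.I * θ) =
      Complex.exp (Complex.I * ((θ + α : ℝ) : ℂ)) := by
    rw [hα, ← Complex.exp_add]
    congr 1
    push_cast
    ring
  rw [bdryFunAt_smul hc h t l hl, e1, hα, exp_I_mul_zpow, mul_assoc _ (Complex.exp _),
    ← Complex.exp_add]
  congr 2
  push_cast
  ring

lemma expAt_smul (w : ℂ) : expAt h t (c * l.1, c * l.2) (hl.smul hc) w =
    expAt h t l hl (conj c / c * w) := by
  have e : HplusAt h t (c * l.1, c * l.2) (hl.smul hc) w = HplusAt h t l hl (conj c / c * w) := by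
    unfold HplusAt
    congr 1
    ext k
    rw [coeffAt_smul hc, mul_pow, mul_assoc]
    norm_cast
  rw [expAt, expAt, e, coeffAt_smul hc, zpow_zero, mul_one]

lemma zpt_smul {c : ℂ} (hc : c ≠ 0) {z₀ z₁ z₂ z₃ z₀' z₁' z₂' z₃' : ℂ}
    {h : ¬(z₀ = 0 ∧ z₁ = 0)} {h' : ¬(z₂ = 0 ∧ z₃ = 0)} {k : ¬(z₀' = 0 ∧ z₁' = 0)}
    {k' : ¬(z₂' = 0 ∧ z₃' = 0)} (e₀ : z₀' = c * z₀) (e₁ : z₁' = c * z₁)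
    (e₂ : z₂' = c * z₂) (e₃ : z₃' = c * z₃) :
    zpt z₀' z₁' z₂' z₃' k k' = zpt z₀ z₁ z₂ z₃ h h' := by
  refine Subtype.ext ((Projectivization.mk_eq_mk_iff' ℂ _ _ _ _).2 ⟨c, ?_⟩)
  ext i
  fin_cases i <;> simp [e₀, e₁, e₂, e₃]

lemma explicitMapAt_smul (w : ℂ) : explicitMapAt h s t (c * l.1, c * l.2) (hl.smul hc) w =
    explicitMapAt h s t l hl (conj c / c * w) := by
  unfold explicitMapAt
  have e : factorAt h s t (c * l.1, c * l.2) (hl.smul hc) w =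
      factorAt h s t l hl (conj c / c * w) := by
    rw [factorAt, factorAt, expAt_smul hc h t l hl]
  refine zpt_smul hc ?_ ?_ ?_ ?_ <;> simp only [e, map_mul] <;> field_simp

lemma image_explicitMapAt_smul : explicitMapAt h s t (c * l.1, c * l.2) (hl.smul hc) '' disk =
    explicitMapAt h s t l hl '' disk := by
  have hn := norm_conj_div hc
  have hn0 : conj c / c ≠ 0 := norm_ne_zero_iff.1 (by rw [hn]; exact one_ne_zero)
  ext z
  constructor
  · rintro ⟨w, hw, rfl⟩
    refine ⟨conj c / c * w, ?_, (explicitMapAt_smul hc h s t l hl w).symm⟩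
    rw [mem_closedBall_zero_iff, norm_mul, hn, one_mul]
    exact mem_closedBall_zero_iff.1 hw
  · rintro ⟨w, hw, rfl⟩
    refine ⟨(conj c / c)⁻¹ * w, ?_, ?_⟩
    · rw [mem_closedBall_zero_iff, norm_mul, norm_inv, hn, inv_one, one_mul]
      exact mem_closedBall_zero_iff.1 hw
    · rw [explicitMapAt_smul hc, mul_inv_cancel_left₀ hn0]

end Rotation

/-! ### Smooth dependence on the parameters -/

/-- Inverse stereographic projection is given in ℝ³ by quotients of real polynomials in the real and
imaginary parts of the homogeneous coordinates, with nonvanishing denominator. A smooth map to ℝ³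
with values in the sphere is smooth into the sphere. -/
lemma contDiff_comp_invStereo {V : Type} [NormedAddCommGroup V] [NormedSpace ℝ V] {h : S2 → ℝ}
    (hh : ContMDiff (𝓡 2) 𝓘(ℝ, ℝ) ∞ h) {a b : V → ℂ} (ha : ContDiff ℝ ∞ a) (hb : ContDiff ℝ ∞ b)
    (hab : ∀ v, ¬(a v = 0 ∧ b v = 0)) :
    ContDiff ℝ ∞ (fun v => h (invStereo (cp1 (a v) (b v) (hab v)))) := by
  have hre : ∀ {f : V → ℂ}, ContDiff ℝ ∞ f → ContDiff ℝ ∞ (fun v => (f v).re) :=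
    fun hf => Complex.reCLM.contDiff.comp hf
  have him : ∀ {f : V → ℂ}, ContDiff ℝ ∞ f → ContDiff ℝ ∞ (fun v => (f v).im) :=
    fun hf => Complex.imCLM.contDiff.comp hf
  have hsq : ∀ {f : V → ℂ}, ContDiff ℝ ∞ f → ContDiff ℝ ∞ (fun v => Complex.normSq (f v)) := by
    intro f hf
    simp only [Complex.normSq_apply]
    exact ((hre hf).mul (hre hf)).add ((him hf).mul (him hf))
  have hm : ContDiff ℝ ∞ (fun v => conj (a v) * b v) :=
    (Complex.conjCLE.contDiff.comp ha).mul hb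
  have hN : ContDiff ℝ ∞ (fun v => Complex.normSq (a v) + Complex.normSq (b v)) :=
    (hsq ha).add (hsq hb)
  have hN0 : ∀ v, Complex.normSq (a v) + Complex.normSq (b v) ≠ 0 := fun v =>
    (normSq_add_pos ⟨![a v, b v], vec2_ne_zero (hab v)⟩).ne'
  have hvec : ContDiff ℝ ∞ (fun v => invStereoVec ⟨![a v, b v], vec2_ne_zero (hab v)⟩) := by
    rw [contDiff_euclidean]
    intro i
    fin_cases i
    · exact ((hsq ha).sub (hsq hb)).div hN hN0
    · exact (contDiff_const.mul (hre hm)).div hN hN0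
    · exact (contDiff_const.mul (him hm)).div hN hN0
  have : Fact (Module.finrank ℝ (EuclideanSpace ℝ (Fin 3)) = 2 + 1) :=
    ⟨finrank_euclideanSpace_fin⟩
  have hs : ContMDiff 𝓘(ℝ, V) (𝓡 2) ∞
      (fun v => (⟨_, invStereoVec_mem ⟨![a v, b v], vec2_ne_zero (hab v)⟩⟩ : S2)) :=
    hvec.contMDiff.codRestrict_sphere fun v => invStereoVec_mem _
  exact (hh.comp hs).contDiff

section Families

variable {h : S2 → ℝ} (hh : ContMDiff (𝓡 2) 𝓘(ℝ, ℝ) ∞ h) {l : ℂ → ℂ × ℂ} (hl : ∀ z, Nonzero (l z))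

/-- The function `H(t, λ; e^{iθ})` for a family of homogeneous coordinates of `λ`. -/
def circleFun (h : S2 → ℝ) {l : ℂ → ℂ × ℂ} (hl : ∀ z, Nonzero (l z)) (q : (ℝ × ℂ) × ℝ) : ℂ :=
  bdryFunAt h q.1.1 (l q.1.2) (hl _) (Complex.exp (Complex.I * q.2))

/-- `e^{-iθ} H(t, λ; e^{iθ})`. -/
def shiftedFun (h : S2 → ℝ) {l : ℂ → ℂ × ℂ} (hl : ∀ z, Nonzero (l z)) (q : (ℝ × ℂ) × ℝ) : ℂ :=
  Complex.exp (-(Complex.I * q.2)) * circleFun h hl q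

lemma anglePeriodic_circleFun (h : S2 → ℝ) : AnglePeriodic (circleFun h hl) := by
  intro p θ
  unfold circleFun
  congr 2
  rw [← Complex.exp_periodic (Complex.I * θ)]
  congr 1
  push_cast
  ring

lemma anglePeriodic_shiftedFun (h : S2 → ℝ) : AnglePeriodic (shiftedFun h hl) := by
  intro p θ
  simp only [shiftedFun, anglePeriodic_circleFun hl h p θ, exp_period]

include hh

lemma contDiff_circleFun (hl' : ContDiff ℝ ∞ l) : ContDiff ℝ ∞ (circleFun h hl) := by
  have h1 : ContDiff ℝ ∞ (fun q : (ℝ × ℂ) × ℝ => (l q.1.2).1) :=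
    contDiff_fst.comp (hl'.comp (contDiff_snd.comp contDiff_fst))
  have h2 : ContDiff ℝ ∞ (fun q : (ℝ × ℂ) × ℝ => (l q.1.2).2) :=
    contDiff_snd.comp (hl'.comp (contDiff_snd.comp contDiff_fst))
  have h3 : ContDiff ℝ ∞ (fun q : (ℝ × ℂ) × ℝ => (Real.exp q.1.1 : ℂ)) :=
    Complex.ofRealCLM.contDiff.comp (Real.contDiff_exp.comp (contDiff_fst.comp contDiff_fst))
  have h4 : ContDiff ℝ ∞ (fun q : (ℝ × ℂ) × ℝ => Complex.exp (Complex.I * q.2)) :=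
    (contDiff_const.mul (Complex.ofRealCLM.contDiff.comp contDiff_snd)).cexp
  have hconj : ∀ {f : (ℝ × ℂ) × ℝ → ℂ}, ContDiff ℝ ∞ f → ContDiff ℝ ∞ (fun q => conj (f q)) :=
    fun hf => Complex.conjCLE.contDiff.comp hf
  exact Complex.ofRealCLM.contDiff.comp (contDiff_comp_invStereo hh
    (((hconj h2).mul h4).add (h1.mul h3)) (((hconj h1).neg.mul h4).add (h2.mul h3))
    fun q => std_ne_zero₁ q.1.1 _ (hl q.1.2) _)

lemma contDiff_shiftedFun (hl' : ContDiff ℝ ∞ l) : ContDiff ℝ ∞ (shiftedFun h hl) :=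
  ((contDiff_const.mul (Complex.ofRealCLM.contDiff.comp contDiff_snd)).neg.cexp).mul
    (contDiff_circleFun hh hl hl')

omit hh

lemma coeffAt_eq_circleCoeff (h : S2 → ℝ) (t : ℝ) (z : ℂ) (k : ℤ) :
    coeffAt h t (l z) (hl z) k = (2 * Real.pi : ℂ)⁻¹ * circleCoeff (circleFun h hl) k (t, z) := by
  unfold coeffAt circleCoeff circleFun
  simp only [smul_eq_mul, mul_comm]

lemma circleCoeff_shiftedFun (h : S2 → ℝ) (k : ℤ) (p : ℝ × ℂ) :
    circleCoeff (shiftedFun h hl) k p = circleCoeff (circleFun h hl) (k + 1) p := by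
  unfold circleCoeff shiftedFun
  refine intervalIntegral.integral_congr fun θ _ => ?_
  simp only [smul_eq_mul]
  rw [← mul_assoc, ← Complex.exp_add]
  congr 2
  push_cast
  ring

/-- H₊ starts at w¹ and the Szegő series at w⁰. Dividing the boundary function by e^{iθ} lowers all
indices by one, and the factor w restores them. -/
lemma HplusAt_eq_szego (h : S2 → ℝ) (t : ℝ) (z w : ℂ) : HplusAt h t (l z) (hl z) w =
    (2 * Real.pi : ℂ)⁻¹ * (w * szego (shiftedFun h hl) ((t, z), w)) := by
  unfold HplusAt szego
  rw [← tsum_mul_left, ← tsum_mul_left]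
  congr 1
  ext k
  rw [coeffAt_eq_circleCoeff, circleCoeff_shiftedFun, smul_eq_mul]
  ring

lemma coeffAt_zero_eq_szego (h : S2 → ℝ) (t : ℝ) (z : ℂ) : coeffAt h t (l z) (hl z) 0 =
    (2 * Real.pi : ℂ)⁻¹ * szego (circleFun h hl) ((t, z), 0) := by
  unfold szego
  rw [tsum_eq_single 0 (by intro n hn; simp [hn]), coeffAt_eq_circleCoeff]
  simp

/-- Smoothness of `e^{2 H₊ + H₀}` up to the boundary, jointly with the parameters. -/
lemma contDiffOn_expAt (hh : ContMDiff (𝓡 2) 𝓘(ℝ, ℝ) ∞ h) (hl' : ContDiff ℝ ∞ l) :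
    ContDiffOn ℝ ∞ (fun x : (ℝ × ℂ) × ℂ => expAt h x.1.1 (l x.1.2) (hl _) x.2)
      (Set.univ ×ˢ disk) := by
  have h1 := contDiffOn_szego (contDiff_shiftedFun hh hl hl') (anglePeriodic_shiftedFun hl h)
  have h2 := contDiffOn_szego (contDiff_circleFun hh hl hl') (anglePeriodic_circleFun hl h)
  have h3 : ContDiffOn ℝ ∞ (fun x : (ℝ × ℂ) × ℂ => szego (circleFun h hl) (x.1, 0))
      (Set.univ ×ˢ disk) :=
    h2.comp (contDiff_fst.prodMk contDiff_const).contDiffOn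
      fun x _ => ⟨trivial, Metric.mem_closedBall_self zero_le_one⟩
  unfold expAt
  simp only [HplusAt_eq_szego, coeffAt_zero_eq_szego]
  exact ((contDiffOn_const.mul (contDiffOn_const.mul (contDiffOn_snd.mul h1))).add
    (contDiffOn_const.mul h3)).cexp

end Families

/-! ### The Fourier splitting -/

section Splitting

variable {h : S2 → ℝ} (hh : ContMDiff (𝓡 2) 𝓘(ℝ, ℝ) ∞ h) (t : ℝ) (l : ℂ × ℂ) (hl : Nonzero l)

include hh

lemma exists_coeffAt_bound : ∃ u : ℤ → ℝ, Summable u ∧ ∀ k, ‖coeffAt h t l hl k‖ ≤ u k := by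
  have hA := contDiff_circleFun hh (l := fun _ => l) (fun _ => hl) contDiff_const
  obtain ⟨u, hu, hb⟩ := exists_circleCoeff_summable_bound hA (anglePeriodic_circleFun _ h) (t, 0)
  refine ⟨fun k => ‖(2 * Real.pi : ℂ)⁻¹‖ * u k, hu.mul_left _, fun k => ?_⟩
  rw [coeffAt_eq_circleCoeff (l := fun _ => l) (fun _ => hl) h t 0, norm_mul]
  exact mul_le_mul_of_nonneg_left (hb k _ (Metric.mem_closedBall_self zero_le_one)) (norm_nonneg _)

lemma hasSum_coeffAt {w : ℂ} (hw : ‖w‖ = 1) :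
    HasSum (fun k : ℤ => coeffAt h t l hl k * w ^ k) (bdryFunAt h t l hl w : ℂ) := by
  obtain ⟨θ, rfl⟩ := exists_exp_of_norm_eq_one hw
  have hA := contDiff_circleFun hh (l := fun _ => l) (fun _ => hl) contDiff_const
  have := hasSum_circleCoeff hA (anglePeriodic_circleFun _ h) (t, 0) θ
  simp only [← coeffAt_eq_circleCoeff] at this
  exact this

lemma bdryFunAt_eq_sum {w : ℂ} (hw : ‖w‖ = 1) : (bdryFunAt h t l hl w : ℂ) =
    (∑' k : ℕ, coeffAt h t l hl (-((k : ℤ) + 1)) * w ^ (-((k : ℤ) + 1))) + coeffAt h t l hl 0 +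
      HplusAt h t l hl w := by
  have hs := hasSum_coeffAt hh t l hl hw
  have h1 : Summable (fun k : ℕ => coeffAt h t l hl k * w ^ (k : ℤ)) :=
    hs.summable.comp_injective (i := fun k : ℕ => (k : ℤ)) Nat.cast_injective
  have h2 : Summable (fun k : ℕ => coeffAt h t l hl (-((k : ℤ) + 1)) * w ^ (-((k : ℤ) + 1))) :=
    hs.summable.comp_injective (i := fun k : ℕ => -((k : ℤ) + 1)) (fun a b h => by simpa using h)
  rw [← hs.tsum_eq, tsum_of_nat_of_neg_add_one (f := fun k : ℤ => coeffAt h t l hl k * w ^ k) h1 h2,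
    h1.tsum_eq_zero_add]
  simp only [Nat.cast_zero, zpow_zero, mul_one, Nat.cast_add, Nat.cast_one, HplusAt]
  rw [add_comm, add_assoc]
  congr 2

-- The boundary function is real valued.
omit hh in
lemma coeffAt_neg (h : S2 → ℝ) (k : ℤ) :
    coeffAt h t l hl (-k) = conj (coeffAt h t l hl k) := by
  unfold coeffAt
  rw [map_mul, map_inv₀, map_mul, Complex.conj_ofReal, Complex.conj_ofNat]
  rw [← intervalIntegral.intervalIntegral_conj]
  congr 1
  refine intervalIntegral.integral_congr fun θ _ => ?_
  simp only [map_mul, Complex.conj_ofReal, ← Complex.exp_conj, map_neg, Complex.conj_I,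
    map_intCast]
  congr 2
  push_cast
  ring

/-- Since H is real and conj w = w⁻¹ on the circle, H₋ = conj H₊. Hence H = Re (2H₊ + H₀), which
explains the factor 2 in the exponent. -/
lemma norm_expAt {w : ℂ} (hw : ‖w‖ = 1) :
    ‖expAt h t l hl w‖ = Real.exp (bdryFunAt h t l hl w) := by
  have h1 : (∑' k : ℕ, coeffAt h t l hl (-((k : ℤ) + 1)) * w ^ (-((k : ℤ) + 1))) =
      conj (HplusAt h t l hl w) := by
    rw [HplusAt, Complex.conj_tsum]
    congr 1
    ext k
    rw [coeffAt_neg, map_mul, zpow_neg, map_pow, ← Complex.inv_eq_conj hw, inv_pow]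
    norm_cast
  have h2 := bdryFunAt_eq_sum hh t l hl hw
  have h3 := coeffAt_neg t l hl h 0
  rw [neg_zero] at h3
  rw [expAt, Complex.norm_exp]
  congr 1
  rw [h1] at h2
  have h4 := congrArg Complex.re h2
  simp only [Complex.ofReal_re, Complex.add_re, Complex.conj_re] at h4
  rw [h4]
  simp
  ring

lemma differentiableOn_expAt : DifferentiableOn ℂ (expAt h t l hl) (Metric.ball 0 1) := by
  obtain ⟨u, hu, hb⟩ := exists_coeffAt_bound hh t l hl
  have : DifferentiableOn ℂ (HplusAt h t l hl) (Metric.ball 0 1) := by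
    refine Complex.differentiableOn_tsum_of_summable_norm (u := fun k : ℕ => u (k + 1))
      (hu.comp_injective (i := fun k : ℕ => (k : ℤ) + 1) (fun a b h => by simpa using h))
      (fun k => (by fun_prop)) Metric.isOpen_ball fun k w hw => ?_
    rw [norm_mul]
    have h1 := norm_pow_le_one (mem_ball_zero_iff.1 hw).le (k + 1)
    have h2 := hb (k + 1)
    nlinarith [norm_nonneg (coeffAt h t l hl (k + 1)), norm_nonneg (w ^ (k + 1))]
  exact ((this.const_mul 2).add_const _).cexp

end Splitting

/-! ### Lifts of the points of a standard disk to `Z` -/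

/-- The lift of `stdMapAt t l hl w` to `Z` with factor `f`. -/
def liftAt (f : ℂ) (hf : f ≠ 0) (t : ℝ) (l : ℂ × ℂ) (hl : Nonzero l) (w : ℂ) : Z :=
  zpt (f * (conj l.2 * w + l.1 * (Real.exp t : ℂ))) (f * (-conj l.1 * w + l.2 * (Real.exp t : ℂ)))
    (-l.1 + conj l.2 * (Real.exp t : ℂ) * w) (l.2 + conj l.1 * (Real.exp t : ℂ) * w)
    (mul_pair_ne_zero hf (std_ne_zero₁ t l hl w)) (std_ne_zero₂ t l hl w)

lemma explicitMapAt_eq (h : S2 → ℝ) (s : Circle) (t : ℝ) (l : ℂ × ℂ) (hl : Nonzero l) (w : ℂ) :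
    explicitMapAt h s t l hl w =
      liftAt (factorAt h s t l hl w) (factorAt_ne_zero h s t l hl w) t l hl w := rfl

lemma exp_ne_zero' (t : ℝ) : (Real.exp t : ℂ) ≠ 0 := by exact_mod_cast (Real.exp_pos t).ne'

section Points

variable {f : ℂ} (hf : f ≠ 0) (t : ℝ) (l : ℂ × ℂ) (hl : Nonzero l) (w : ℂ)

include hf hl in
lemma liftVec_ne_zero : liftVec f t l w ≠ 0 :=
  vec4_ne_zero (mul_pair_ne_zero hf (std_ne_zero₁ t l hl w))

lemma proj_liftAt : proj (liftAt f hf t l hl w) = stdMapAt t l hl w := by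
  rw [liftAt, proj_zpt, stdMapAt]
  congr 1
  exact cp1_smul hf _ rfl rfl _

/-- The functional `conj l₀ z₀ + conj l₁ z₁`. -/
def headForm (l : ℂ × ℂ) (z : Fin 4 → ℂ) : ℂ := conj l.1 * z 0 + conj l.2 * z 1

/-- The functional `l₁ z₀ - l₀ z₁`. -/
def skewForm (l : ℂ × ℂ) (z : Fin 4 → ℂ) : ℂ := l.2 * z 0 - l.1 * z 1

/-- The functional `conj l₁ z₃ - conj l₀ z₂`. -/
def tailForm (l : ℂ × ℂ) (z : Fin 4 → ℂ) : ℂ := conj l.2 * z 3 - conj l.1 * z 2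

variable {w t l} {z : Fin 4 → ℂ} {κ : ℂ}

/-- The three linear forms invert the lift: up to the common factor κ(|l₀|² + |l₁|²) they take the
values f eᵗ, f w and 1, so that w and f are ratios of them. -/
lemma headForm_eq (hz : z = κ • liftVec f t l w) : headForm l z =
    κ * f * Real.exp t * (l.1 * conj l.1 + l.2 * conj l.2) := by
  simp only [headForm, hz, liftVec, Pi.smul_apply, smul_eq_mul, Matrix.cons_val_zero,
    Matrix.cons_val_one]
  ring

lemma skewForm_eq (hz : z = κ • liftVec f t l w) : skewForm l z =
    κ * f * w * (l.1 * conj l.1 + l.2 * conj l.2) := by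
  simp only [skewForm, hz, liftVec, Pi.smul_apply, smul_eq_mul, Matrix.cons_val_zero,
    Matrix.cons_val_one]
  ring

lemma tailForm_eq (hz : z = κ • liftVec f t l w) : tailForm l z =
    κ * (l.1 * conj l.1 + l.2 * conj l.2) := by
  simp only [tailForm, hz, liftVec, Pi.smul_apply, smul_eq_mul, Matrix.cons_val]
  ring

lemma exists_smul_of_liftAt_eq {hz : z ≠ 0}
    (h : (liftAt f hf t l hl w).1 = Projectivization.mk ℂ z hz) :
    ∃ κ : ℂ, κ ≠ 0 ∧ z = κ • liftVec f t l w := by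
  obtain ⟨κ, hκ⟩ := (Projectivization.mk_eq_mk_iff ℂ z (liftVec f t l w) hz
    (liftVec_ne_zero hf t l hl w)).1 h.symm
  exact ⟨κ, κ.ne_zero, hκ.symm⟩

lemma headForm_ne_zero {hz : z ≠ 0}
    (h : (liftAt f hf t l hl w).1 = Projectivization.mk ℂ z hz) : headForm l z ≠ 0 := by
  obtain ⟨κ, hκ, h⟩ := exists_smul_of_liftAt_eq hf hl h
  rw [headForm_eq h]
  exact mul_ne_zero (mul_ne_zero (mul_ne_zero hκ hf) (exp_ne_zero' t)) (det_aux _ _ hl)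

lemma tailForm_ne_zero {hz : z ≠ 0}
    (h : (liftAt f hf t l hl w).1 = Projectivization.mk ℂ z hz) : tailForm l z ≠ 0 := by
  obtain ⟨κ, hκ, h⟩ := exists_smul_of_liftAt_eq hf hl h
  rw [tailForm_eq h]
  exact mul_ne_zero hκ (det_aux _ _ hl)

lemma eq_of_liftAt_eq {hz : z ≠ 0}
    (h : (liftAt f hf t l hl w).1 = Projectivization.mk ℂ z hz) :
    w = Real.exp t * skewForm l z / headForm l z ∧
      f = headForm l z / (Real.exp t * tailForm l z) := by
  have h1 := headForm_ne_zero hf hl h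
  have h2 := mul_ne_zero (exp_ne_zero' t) (tailForm_ne_zero hf hl h)
  obtain ⟨κ, hκ, h⟩ := exists_smul_of_liftAt_eq hf hl h
  constructor
  · rw [eq_div_iff h1, headForm_eq h, skewForm_eq h]
    ring
  · rw [eq_div_iff h2, headForm_eq h, tailForm_eq h]
    ring

lemma liftAt_injective {f' : ℂ} {hf' : f' ≠ 0} {w' : ℂ}
    (h : liftAt f hf t l hl w = liftAt f' hf' t l hl w') : w = w' ∧ f = f' := by
  have h1 := eq_of_liftAt_eq hf hl (hz := liftVec_ne_zero hf t l hl w) (by rfl)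
  have h2 := eq_of_liftAt_eq hf' hl (hz := liftVec_ne_zero hf t l hl w) (by rw [← h]; rfl)
  exact ⟨h1.1.trans h2.1.symm, h1.2.trans h2.2.symm⟩

lemma stdMapAt_injective : Function.Injective (stdMapAt t l hl) := by
  intro w w' h
  obtain ⟨κ, hκ⟩ := (Projectivization.mk_eq_mk_iff' ℂ _ _ _ _).1 (congrArg Prod.fst h)
  have e0 := congrFun hκ 0
  have e1 := congrFun hκ 1
  simp only [Pi.smul_apply, smul_eq_mul, Matrix.cons_val_zero, Matrix.cons_val_one] at e0 e1
  have hd := det_aux _ _ hl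
  have e2 : κ * Real.exp t * (l.1 * conj l.1 + l.2 * conj l.2) =
      1 * Real.exp t * (l.1 * conj l.1 + l.2 * conj l.2) := by
    linear_combination conj l.1 * e0 + conj l.2 * e1
  have e3 : κ = 1 := mul_right_cancel₀ (exp_ne_zero' t) (mul_right_cancel₀ hd e2)
  rw [e3] at e0 e1
  exact (mul_right_cancel₀ hd (by linear_combination l.2 * e0 - l.1 * e1)).symm

/-- Every point of `Z` over `stdMapAt t l hl w` is a lift. -/
lemma exists_liftAt {p : Z} (h : proj p = stdMapAt t l hl w) :
    ∃ (f : ℂ) (hf : f ≠ 0), p = liftAt f hf t l hl w := by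
  obtain ⟨α, hα⟩ := (Projectivization.mk_eq_mk_iff ℂ _ _ _ _).1 (congrArg Prod.fst h)
  obtain ⟨β, hβ⟩ := (Projectivization.mk_eq_mk_iff ℂ _ _ _ _).1 (congrArg Prod.snd h)
  have a0 := congrFun hα 0
  have a1 := congrFun hα 1
  have b0 := congrFun hβ 0
  have b1 := congrFun hβ 1
  simp only [Pi.smul_apply, Units.smul_def, smul_eq_mul, Matrix.cons_val_zero,
    Matrix.cons_val_one] at a0 a1 b0 b1
  have hβ0 := β.ne_zero
  -- The two halves of the coordinate vector are proportional to the standard ones with constants α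
  -- and β; only their ratio survives projectively.
  refine ⟨α / β, div_ne_zero α.ne_zero hβ0, Subtype.ext ?_⟩
  rw [← p.1.mk_rep]
  refine (Projectivization.mk_eq_mk_iff' ℂ _ _ _ _).2 ⟨β, ?_⟩
  ext i
  fin_cases i
  · simp [← a0]; field_simp
  · simp [← a1]; field_simp
  · simp [← b0]
  · simp [← b1]

/-- On the circle conj w = w⁻¹, so conjugation exchanges the coordinates of η₁ with those of η₂, in
reversed order and up to conj w. This is why the boundary of a standard disk can be lifted to `P_h`.
-/
lemma conj_std₁ (hw : ‖w‖ = 1) : conj (conj l.2 * w + l.1 * (Real.exp t : ℂ)) =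
    conj w * (l.2 + conj l.1 * (Real.exp t : ℂ) * w) := by
  have : conj w * w = 1 := by rw [← Complex.normSq_eq_conj_mul_self, Complex.normSq_eq_norm_sq, hw]; simp
  simp only [map_add, map_mul, Complex.conj_conj, Complex.conj_ofReal]
  linear_combination -(conj l.1 * Real.exp t) * this

lemma conj_std₂ (hw : ‖w‖ = 1) : conj (-conj l.1 * w + l.2 * (Real.exp t : ℂ)) =
    conj w * (-l.1 + conj l.2 * (Real.exp t : ℂ) * w) := by
  have : conj w * w = 1 := by rw [← Complex.normSq_eq_conj_mul_self, Complex.normSq_eq_norm_sq, hw]; simp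
  simp only [map_add, map_mul, map_neg, Complex.conj_conj, Complex.conj_ofReal]
  linear_combination -(conj l.2 * Real.exp t) * this

/-- For coordinates scaled by κ both equations of `P_h` become κ = conj (κ f) conj w e^{-H}. Its
modulus gives |f| = e^H, and its argument can always be satisfied by the choice of κ. -/
lemma liftAt_mem_realSub_iff (h : S2 → ℝ) (hw : ‖w‖ = 1) :
    liftAt f hf t l hl w ∈ realSub h ↔ ‖f‖ = Real.exp (bdryFunAt h t l hl w) := by
  constructor
  · rintro ⟨z₀, z₁, z₂, z₃, h₁, h₂, hp, h3, h2⟩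
    obtain ⟨κ, hκ, hz⟩ := exists_smul_of_liftAt_eq (z := ![z₀, z₁, z₂, z₃]) hf hl
      (hz := vec4_ne_zero h₁) (by rw [hp]; rfl)
    have e0 : z₀ = κ * f * (conj l.2 * w + l.1 * (Real.exp t : ℂ)) := by
      rw [mul_assoc]; exact congrFun hz 0
    have e1 : z₁ = κ * f * (-conj l.1 * w + l.2 * (Real.exp t : ℂ)) := by
      rw [mul_assoc]; exact congrFun hz 1
    have e2 : z₂ = κ * (-l.1 + conj l.2 * (Real.exp t : ℂ) * w) := congrFun hz 2
    have e3 : z₃ = κ * (l.2 + conj l.1 * (Real.exp t : ℂ) * w) := congrFun hz 3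
    have hb : h (invStereo (cp1 z₀ z₁ h₁)) = bdryFunAt h t l hl w := by
      rw [cp1_smul (mul_ne_zero hκ hf) (std_ne_zero₁ t l hl w) e0 e1 h₁]
      rfl
    rw [hb, e0, map_mul, conj_std₁ hw, e3] at h3
    rw [hb, e1, map_mul, conj_std₂ hw, e2] at h2
    have key : κ = conj (κ * f) * conj w * (Real.exp (-bdryFunAt h t l hl w) : ℂ) := by
      -- The coordinates of η₂ do not both vanish, so one of the two equations can be divided by its
      -- coordinate.
      by_cases hc : -l.1 + conj l.2 * (Real.exp t : ℂ) * w = 0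
      · have hd : l.2 + conj l.1 * (Real.exp t : ℂ) * w ≠ 0 :=
          fun hd => std_ne_zero₂ t l hl w ⟨hc, hd⟩
        exact mul_right_cancel₀ hd (by linear_combination h3)
      · exact mul_right_cancel₀ hc (by linear_combination h2)
    have hn := congrArg norm key
    rw [norm_mul, norm_mul, RCLike.norm_conj, RCLike.norm_conj, hw, norm_mul, mul_one,
      Complex.norm_real, Real.norm_of_nonneg (Real.exp_pos _).le, Real.exp_neg, mul_assoc] at hn
    have hκ' : ‖κ‖ ≠ 0 := norm_ne_zero_iff.2 hκ
    have h1 : ‖f‖ * (Real.exp (bdryFunAt h t l hl w))⁻¹ = 1 :=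
      mul_left_cancel₀ hκ' (by linarith)
    field_simp at h1
    exact h1
  · intro hn
    have hu : ‖conj f * conj w * (Real.exp (-bdryFunAt h t l hl w) : ℂ)‖ = 1 := by
      rw [norm_mul, norm_mul, RCLike.norm_conj, RCLike.norm_conj, hw, mul_one, hn,
        Complex.norm_real, Real.norm_of_nonneg (Real.exp_pos _).le, ← Real.exp_add, add_neg_cancel,
        Real.exp_zero]
    obtain ⟨α, hα⟩ := exists_exp_of_norm_eq_one hu
    -- The scaling must satisfy c / conj c = e^{iα}, which half the angle achieves.
    let c : ℂ := Complex.exp (Complex.I * ((α / 2 : ℝ) : ℂ))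
    have hc : c ≠ 0 := Complex.exp_ne_zero _
    have hcc : c = conj c * (conj f * conj w * (Real.exp (-bdryFunAt h t l hl w) : ℂ)) := by
      rw [hα, ← Complex.exp_conj, ← Complex.exp_add]
      simp only [c, map_mul, Complex.conj_I, Complex.conj_ofReal]
      congr 1
      push_cast
      ring
    have h₁ := mul_pair_ne_zero hc (mul_pair_ne_zero hf (std_ne_zero₁ t l hl w))
    refine ⟨_, _, _, _, h₁, mul_pair_ne_zero hc (std_ne_zero₂ t l hl w),
      (zpt_smul hc rfl rfl rfl rfl).symm, ?_, ?_⟩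
    all_goals
      have hb : h (invStereo (cp1 _ _ h₁)) = bdryFunAt h t l hl w := by
        rw [cp1_smul (mul_ne_zero hc hf) (std_ne_zero₁ t l hl w) (by ring) (by ring) h₁]
        rfl
      rw [hb, map_mul, map_mul]
    · rw [conj_std₁ hw]
      linear_combination (l.2 + conj l.1 * (Real.exp t : ℂ) * w) * hcc
    · rw [conj_std₂ hw]
      linear_combination (-l.1 + conj l.2 * (Real.exp t : ℂ) * w) * hcc

end Points

/-! ### The explicit disks -/

section Explicit

variable {h : S2 → ℝ} (hh : ContMDiff (𝓡 2) 𝓘(ℝ, ℝ) ∞ h)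

lemma proj_explicitMapAt (h : S2 → ℝ) (s : Circle) (t : ℝ) (l : ℂ × ℂ) (hl : Nonzero l) (w : ℂ) :
    proj (explicitMapAt h s t l hl w) = stdMapAt t l hl w := by
  rw [explicitMapAt_eq, proj_liftAt]

lemma norm_factorAt (h : S2 → ℝ) (s : Circle) (t : ℝ) (l : ℂ × ℂ) (hl : Nonzero l) (w : ℂ) :
    ‖factorAt h s t l hl w‖ = ‖expAt h t l hl w‖ := by
  rw [factorAt, norm_mul, norm_mul, norm_neg, Complex.norm_I, Circle.norm_coe, one_mul, one_mul]

include hh in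
lemma explicitMapAt_mem_realSub (s : Circle) (t : ℝ) (l : ℂ × ℂ) (hl : Nonzero l) {w : ℂ}
    (hw : ‖w‖ = 1) : explicitMapAt h s t l hl w ∈ realSub h := by
  rw [explicitMapAt_eq, liftAt_mem_realSub_iff _ _ h hw, norm_factorAt, norm_expAt hh t l hl hw]

lemma explicitMapAt_injective (h : S2 → ℝ) (s : Circle) (t : ℝ) (l : ℂ × ℂ) (hl : Nonzero l) :
    Function.Injective (explicitMapAt h s t l hl) := by
  intro w w' e
  apply stdMapAt_injective (t := t) hl
  rw [← proj_explicitMapAt h s, e, proj_explicitMapAt]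

include hh in
lemma holomorphicOn_explicitMapAt (s : Circle) (t : ℝ) (l : ℂ × ℂ) (hl : Nonzero l) :
    HolomorphicOn (explicitMapAt h s t l hl) (Metric.ball 0 1) := by
  intro x _
  refine ⟨Set.univ, fun w => liftVec (factorAt h s t l hl w) t l w, isOpen_univ, trivial, ?_,
    fun w _ => ⟨liftVec_ne_zero (factorAt_ne_zero h s t l hl w) t l hl w, rfl⟩⟩
  rw [Set.inter_univ]
  have hf : DifferentiableOn ℂ (factorAt h s t l hl) (Metric.ball 0 1) :=
    (differentiableOn_expAt hh t l hl).const_mul _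
  rw [differentiableOn_pi]
  intro i
  fin_cases i
  · exact hf.mul (Differentiable.differentiableOn (by fun_prop))
  · exact hf.mul (Differentiable.differentiableOn (by fun_prop))
  · exact Differentiable.differentiableOn
      (f := fun w => -l.1 + conj l.2 * (Real.exp t : ℂ) * w) (by fun_prop)
  · exact Differentiable.differentiableOn
      (f := fun w => l.2 + conj l.1 * (Real.exp t : ℂ) * w) (by fun_prop)

-- The point s of the circle is replaced by a free complex variable and λ by a local coordinate, so
-- that joint smoothness is a statement about vector spaces.
include hh in
lemma contDiffOn_liftVec {l : ℂ → ℂ × ℂ} (hl : ∀ z, Nonzero (l z)) (hl' : ContDiff ℝ ∞ l) :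
    ContDiffOn ℝ ∞ (fun x : (ℂ × ℝ × ℂ) × ℂ =>
      liftVec (-Complex.I * x.1.1 * expAt h x.1.2.1 (l x.1.2.2) (hl _) x.2) x.1.2.1 (l x.1.2.2) x.2)
      (Set.univ ×ˢ disk) := by
  have hf : ContDiffOn ℝ ∞ (fun x : (ℂ × ℝ × ℂ) × ℂ =>
      -Complex.I * x.1.1 * expAt h x.1.2.1 (l x.1.2.2) (hl _) x.2) (Set.univ ×ˢ disk) := by
    refine (contDiff_const.mul (contDiff_fst.comp contDiff_fst)).contDiffOn.mul ?_
    exact (contDiffOn_expAt hl hh hl').comp (s := Set.univ ×ˢ disk)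
      (f := fun x : (ℂ × ℝ × ℂ) × ℂ => (x.1.2, x.2))
      ((contDiff_snd.comp contDiff_fst).prodMk contDiff_snd).contDiffOn (fun x hx => ⟨trivial, hx.2⟩)
  have hw : ContDiff ℝ ∞ (fun x : (ℂ × ℝ × ℂ) × ℂ => x.2) := contDiff_snd
  have h1 : ContDiff ℝ ∞ (fun x : (ℂ × ℝ × ℂ) × ℂ => (l x.1.2.2).1) :=
    contDiff_fst.comp (hl'.comp (contDiff_snd.comp (contDiff_snd.comp contDiff_fst)))
  have h2 : ContDiff ℝ ∞ (fun x : (ℂ × ℝ × ℂ) × ℂ => (l x.1.2.2).2) :=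
    contDiff_snd.comp (hl'.comp (contDiff_snd.comp (contDiff_snd.comp contDiff_fst)))
  have h3 : ContDiff ℝ ∞ (fun x : (ℂ × ℝ × ℂ) × ℂ => (Real.exp x.1.2.1 : ℂ)) :=
    Complex.ofRealCLM.contDiff.comp
      (Real.contDiff_exp.comp (contDiff_fst.comp (contDiff_snd.comp contDiff_fst)))
  have hconj : ∀ {f : (ℂ × ℝ × ℂ) × ℂ → ℂ}, ContDiff ℝ ∞ f → ContDiff ℝ ∞ (fun q => conj (f q)) :=
    fun hf => Complex.conjCLE.contDiff.comp hf
  rw [contDiffOn_pi]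
  intro i
  fin_cases i
  · exact hf.mul (((hconj h2).mul hw).add (h1.mul h3)).contDiffOn
  · exact hf.mul (((hconj h1).neg.mul hw).add (h2.mul h3)).contDiffOn
  · exact (h1.neg.add (((hconj h2).mul h3).mul hw)).contDiffOn
  · exact (h2.add (((hconj h1).mul h3).mul hw)).contDiffOn

lemma contMDiff_circle_coe : ContMDiff (𝓡 1) 𝓘(ℝ, ℂ) ∞ (fun s : Circle => (s : ℂ)) := by
  have := finrank_real_complex_fact'
  exact contMDiff_coe_sphere (E := ℂ) (n := 1)

lemma contMDiffOn_joint {V : Set S2} {z : S2 → ℂ} (hz : ContMDiffOn (𝓡 2) 𝓘(ℝ, ℂ) ∞ z V) :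
    ContMDiffOn (paramModel.prod 𝓘(ℝ, ℂ)) 𝓘(ℝ, (ℂ × ℝ × ℂ) × ℂ) ∞
      (fun x : Param × ℂ => (((x.1.1 : ℂ), x.1.2.1, z x.1.2.2), x.2))
      ({m | m.2.2 ∈ V} ×ˢ disk) := by
  have hs : ContMDiff (paramModel.prod 𝓘(ℝ, ℂ)) 𝓘(ℝ, ℂ) ∞ (fun x : Param × ℂ => (x.1.1 : ℂ)) :=
    contMDiff_circle_coe.comp (contMDiff_fst.comp contMDiff_fst)
  have ht : ContMDiff (paramModel.prod 𝓘(ℝ, ℂ)) 𝓘(ℝ, ℝ) ∞ (fun x : Param × ℂ => x.1.2.1) :=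
    contMDiff_fst.comp (contMDiff_snd.comp contMDiff_fst)
  have hy : ContMDiff (paramModel.prod 𝓘(ℝ, ℂ)) (𝓡 2) ∞ (fun x : Param × ℂ => x.1.2.2) :=
    contMDiff_snd.comp (contMDiff_snd.comp contMDiff_fst)
  have hw : ContMDiff (paramModel.prod 𝓘(ℝ, ℂ)) 𝓘(ℝ, ℂ) ∞ (fun x : Param × ℂ => x.2) :=
    contMDiff_snd
  have hzy : ContMDiffOn (paramModel.prod 𝓘(ℝ, ℂ)) 𝓘(ℝ, ℂ) ∞ (fun x : Param × ℂ => z x.1.2.2)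
      ({m | m.2.2 ∈ V} ×ˢ disk) := hz.comp hy.contMDiffOn fun x hx => hx.1
  have h1 := ht.contMDiffOn.prodMk_space hzy
  have h2 := hs.contMDiffOn.prodMk_space h1
  exact h2.prodMk_space hw.contMDiffOn

include hh in
lemma smoothOn_explicitMapAt {l : ℂ → ℂ × ℂ} (hl : ∀ z, Nonzero (l z)) (hl' : ContDiff ℝ ∞ l)
    {V : Set S2} {z : S2 → ℂ} (hz : ContMDiffOn (𝓡 2) 𝓘(ℝ, ℂ) ∞ z V) :
    SmoothOn (paramModel.prod 𝓘(ℝ, ℂ))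
      (fun x : Param × ℂ => explicitMapAt h x.1.1 x.1.2.1 (l (z x.1.2.2)) (hl _) x.2)
      ({m | m.2.2 ∈ V} ×ˢ disk) := by
  intro x _
  refine ⟨Set.univ, fun x => liftVec (factorAt h x.1.1 x.1.2.1 (l (z x.1.2.2)) (hl _) x.2)
    x.1.2.1 (l (z x.1.2.2)) x.2, isOpen_univ, trivial, ?_,
    fun x _ => ⟨liftVec_ne_zero
      (factorAt_ne_zero h x.1.1 x.1.2.1 (l (z x.1.2.2)) (hl _) x.2) _ _ (hl _) _, rfl⟩⟩
  rw [Set.inter_univ]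
  have := (contDiffOn_liftVec hh hl hl').contMDiffOn
  have key := this.comp (contMDiffOn_joint hz) fun x hx => ⟨trivial, hx.2⟩
  exact key

lemma SmoothOn.slice {F : Param × ℂ → Z} {U : Set Param}
    (hF : SmoothOn (paramModel.prod 𝓘(ℝ, ℂ)) F (U ×ˢ disk)) {m : Param} (hm : m ∈ U) :
    SmoothOn 𝓘(ℝ, ℂ) (fun w => F (m, w)) disk := by
  intro w hw
  obtain ⟨V, z, hV, hmV, hz, he⟩ := hF (m, w) ⟨hm, hw⟩
  refine ⟨(fun w => (m, w)) ⁻¹' V, fun w => z (m, w), hV.preimage (Continuous.prodMk_right m), hmV,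
    ?_, fun x hx => he (m, x) ⟨⟨hm, hx.1⟩, hx.2⟩⟩
  exact hz.comp (contMDiff_const.prodMk contMDiff_id).contMDiffOn
    fun x hx => ⟨⟨hm, hx.1⟩, hx.2⟩

/-! ### Smooth homogeneous coordinates on the sphere -/

/-- The coordinate `λ`. -/
def coordZero (y : S2) : ℂ := ((y.1 1 : ℂ) + Complex.I * (y.1 2 : ℂ)) / (1 + (y.1 0 : ℂ))

/-- The coordinate `1 / λ`. -/
def coordInfty (y : S2) : ℂ := ((y.1 1 : ℂ) - Complex.I * (y.1 2 : ℂ)) / (1 - (y.1 0 : ℂ))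

lemma nonzero_one_left (z : ℂ) : Nonzero (1, z) := by simp

lemma nonzero_one_right (z : ℂ) : Nonzero (z, 1) := by simp

lemma homCoord_eq_coordZero {y : S2} (hy : y.1 0 ≠ -1) : homCoord y = (1, coordZero y) := by
  rw [homCoord, if_neg hy, coordZero]

lemma one_add_ofReal_ne_zero {r : ℝ} (hr : r ≠ -1) : (1 : ℂ) + (r : ℂ) ≠ 0 := fun e => hr (by
  have := congrArg Complex.re e
  simp at this
  linarith)

lemma one_sub_ofReal_ne_zero {r : ℝ} (hr : r ≠ 1) : (1 : ℂ) - (r : ℂ) ≠ 0 := fun e => hr (by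
  have := congrArg Complex.re e
  simp at this
  linarith)

/-- By the equation of the sphere, `coordInfty` and `coordZero` are inverse to each other where both
are defined. At λ = ∞ the two choices of coordinates agree and c = 1. -/
lemma exists_coordInfty_eq_smul {y : S2} (hy : y.1 0 ≠ 1) :
    ∃ c : ℂ, c ≠ 0 ∧ (coordInfty y, 1) = (c * (homCoord y).1, c * (homCoord y).2) := by
  have hs := sphere_eq y
  by_cases h : y.1 0 = -1
  · have h1 : y.1 1 = 0 := by nlinarith [sq_nonneg (y.1 1), sq_nonneg (y.1 2)]
    have h2 : y.1 2 = 0 := by nlinarith [sq_nonneg (y.1 1), sq_nonneg (y.1 2)]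
    exact ⟨1, one_ne_zero, by simp [coordInfty, homCoord, h, h1, h2]⟩
  · have a1 := one_add_ofReal_ne_zero h
    have a2 := one_sub_ofReal_ne_zero hy
    have hs' : (y.1 0 : ℂ) ^ 2 + (y.1 1 : ℂ) ^ 2 + (y.1 2 : ℂ) ^ 2 = 1 := by
      have := congrArg (fun r : ℝ => (r : ℂ)) hs
      push_cast at this
      exact this
    have key : coordInfty y * coordZero y = 1 := by
      rw [coordInfty, coordZero, div_mul_div_comm, div_eq_one_iff_eq (mul_ne_zero a2 a1)]
      linear_combination hs' - (y.1 2 : ℂ) ^ 2 * Complex.I_mul_I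
    refine ⟨coordInfty y, left_ne_zero_of_mul_eq_one key, ?_⟩
    rw [homCoord_eq_coordZero h, mul_one, key]

lemma contDiff_coord (i : Fin 3) :
    ContDiff ℝ ∞ (fun v : EuclideanSpace ℝ (Fin 3) => ((v i : ℝ) : ℂ)) :=
  (Complex.ofRealCLM.comp (EuclideanSpace.proj i : EuclideanSpace ℝ (Fin 3) →L[ℝ] ℝ)).contDiff

lemma contMDiff_coe_S2 :
    ContMDiff (𝓡 2) 𝓘(ℝ, EuclideanSpace ℝ (Fin 3)) ∞ (fun y : S2 => y.1) := by
  have : Fact (Module.finrank ℝ (EuclideanSpace ℝ (Fin 3)) = 2 + 1) :=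
    ⟨finrank_euclideanSpace_fin⟩
  exact contMDiff_coe_sphere

lemma contMDiffOn_coordZero :
    ContMDiffOn (𝓡 2) 𝓘(ℝ, ℂ) ∞ coordZero {y | y.1 0 ≠ -1} := by
  have h : ContDiffOn ℝ ∞ (fun v : EuclideanSpace ℝ (Fin 3) =>
      ((v 1 : ℂ) + Complex.I * (v 2 : ℂ)) / (1 + (v 0 : ℂ))) {v | v 0 ≠ -1} := by
    simp only [div_eq_mul_inv]
    exact ((contDiff_coord 1).add (contDiff_const.mul (contDiff_coord 2))).contDiffOn.mul
      ((contDiff_const.add (contDiff_coord 0)).contDiffOn.inv fun v hv => one_add_ofReal_ne_zero hv)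
  exact h.contMDiffOn.comp contMDiff_coe_S2.contMDiffOn fun y hy => hy

lemma contMDiffOn_coordInfty :
    ContMDiffOn (𝓡 2) 𝓘(ℝ, ℂ) ∞ coordInfty {y | y.1 0 ≠ 1} := by
  have h : ContDiffOn ℝ ∞ (fun v : EuclideanSpace ℝ (Fin 3) =>
      ((v 1 : ℂ) - Complex.I * (v 2 : ℂ)) / (1 - (v 0 : ℂ))) {v | v 0 ≠ 1} := by
    simp only [div_eq_mul_inv]
    exact ((contDiff_coord 1).sub (contDiff_const.mul (contDiff_coord 2))).contDiffOn.mul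
      ((contDiff_const.sub (contDiff_coord 0)).contDiffOn.inv fun v hv => one_sub_ofReal_ne_zero hv)
  exact h.contMDiffOn.comp contMDiff_coe_S2.contMDiffOn fun y hy => hy

/-- Near every point of `S²` there are smooth homogeneous coordinates of `λ`, proportional to
`homCoord`. -/
lemma exists_local_coord (y₀ : S2) : ∃ (l : ℂ → ℂ × ℂ) (z : S2 → ℂ) (V : Set S2),
    (∀ z, Nonzero (l z)) ∧ ContDiff ℝ ∞ l ∧ IsOpen V ∧ y₀ ∈ V ∧
    ContMDiffOn (𝓡 2) 𝓘(ℝ, ℂ) ∞ z V ∧ ∀ y ∈ V, ∃ c : ℂ, c ≠ 0 ∧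
      l (z y) = (c * (homCoord y).1, c * (homCoord y).2) := by
  have hc : Continuous (fun y : S2 => y.1 0) :=
    (EuclideanSpace.proj (𝕜 := ℝ) (0 : Fin 3)).continuous.comp continuous_subtype_val
  by_cases hy : y₀.1 0 = -1
  · exact ⟨fun z => (z, 1), coordInfty, {y | y.1 0 ≠ 1}, nonzero_one_right,
      contDiff_id.prodMk contDiff_const, isOpen_ne_fun hc continuous_const,
      by simp only [Set.mem_ofPred_eq, hy]; norm_num,
      contMDiffOn_coordInfty, fun y hy => exists_coordInfty_eq_smul hy⟩
  · exact ⟨fun z => (1, z), coordZero, {y | y.1 0 ≠ -1}, nonzero_one_left,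
      contDiff_const.prodMk contDiff_id, isOpen_ne_fun hc continuous_const, hy,
      contMDiffOn_coordZero, fun y hy => ⟨1, one_ne_zero, by
        rw [homCoord_eq_coordZero hy, one_mul, one_mul]⟩⟩

lemma image_explicitMapAt_eq (h : S2 → ℝ) (s : Circle) (t : ℝ) (y : S2) {l : ℂ × ℂ}
    (hl : Nonzero l) {c : ℂ} (hc : c ≠ 0) (e : l = (c * (homCoord y).1, c * (homCoord y).2)) :
    explicitMapAt h s t l hl '' disk = explicitMap h s t y '' disk := by
  subst e
  exact image_explicitMapAt_smul hc h s t _ (homCoord_ne_zero y)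

include hh in
/-- The explicit disks form a smooth family. -/
lemma isSmoothDiskFamily_explicitMap :
    IsSmoothDiskFamily (realSub h) (fun m => explicitMap h m.1 m.2.1 m.2.2 '' disk) := by
  intro m₀
  -- Parametrizing through `homCoord` would be discontinuous at λ = ∞; smooth local coordinates give
  -- the same images.
  obtain ⟨l, z, V, hl, hl', hV, hm, hz, hc⟩ := exists_local_coord m₀.2.2
  have hS := smoothOn_explicitMapAt hh hl hl' hz
  refine ⟨{m | m.2.2 ∈ V},
    fun x : Param × ℂ => explicitMapAt h x.1.1 x.1.2.1 (l (z x.1.2.2)) (hl _) x.2,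
    hV.preimage (continuous_snd.comp continuous_snd), hm, hS, fun m hmU => ?_⟩
  obtain ⟨c, hc0, e⟩ := hc m.2.2 hmU
  have hD : IsDiskMap (explicitMapAt h m.1 m.2.1 (l (z m.2.2)) (hl (z m.2.2))) :=
    ⟨hS.slice hmU, holomorphicOn_explicitMapAt hh m.1 m.2.1 (l (z m.2.2)) (hl _)⟩
  have key : ParametrizesDisk (realSub h) (explicitMapAt h m.1 m.2.1 (l (z m.2.2)) (hl (z m.2.2)))
      (explicitMap h m.1 m.2.1 m.2.2 '' disk) :=
    ⟨hD, (explicitMapAt_injective h m.1 m.2.1 (l (z m.2.2)) (hl _)).injOn,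
      image_explicitMapAt_eq h m.1 m.2.1 m.2.2 (hl _) hc0 e, fun w hw =>
      explicitMapAt_mem_realSub hh m.1 m.2.1 (l (z m.2.2)) (hl _) hw⟩
  exact key

lemma isDiskMap_explicitMapAt (hh : ContMDiff (𝓡 2) 𝓘(ℝ, ℝ) ∞ h) (s : Circle) (t : ℝ) (l : ℂ × ℂ)
    (hl : Nonzero l) : IsDiskMap (explicitMapAt h s t l hl) := by
  refine ⟨?_, holomorphicOn_explicitMapAt hh s t l hl⟩
  have hS := smoothOn_explicitMapAt hh (l := fun _ => l) (fun _ => hl) contDiff_const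
    (V := Set.univ) (z := fun _ => 0) contMDiffOn_const
  -- The coordinates `l` are constant here, so the point of the sphere is arbitrary.
  exact hS.slice (m := (s, t, ⟨_, invStereoVec_mem ⟨![1, 0], vec2_ne_zero (by simp)⟩⟩)) trivial

include hh in
lemma mapsBiholomorphically_explicitMap (s : Circle) (t : ℝ) (y : S2) :
    MapsBiholomorphically (explicitMap h s t y '' disk) t y := by
  have hp : ∀ w, proj (explicitMap h s t y w) = stdMap t y w :=
    proj_explicitMapAt h s t _ (homCoord_ne_zero y)
  refine ⟨⟨?_, ?_, ?_⟩, explicitMap h s t y, isDiskMap_explicitMapAt hh s t _ (homCoord_ne_zero y),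
    fun w hw => ⟨⟨w, hw, rfl⟩, hp w⟩⟩
  · rintro _ ⟨w, hw, rfl⟩
    exact ⟨w, hw, (hp w).symm⟩
  · rintro _ ⟨w, hw, rfl⟩ _ ⟨w', hw', rfl⟩ e
    rw [hp, hp] at e
    rw [stdMapAt_injective (homCoord_ne_zero y) (t := t) e]
  · rintro _ ⟨w, hw, rfl⟩
    exact ⟨_, ⟨w, hw, rfl⟩, hp w⟩

end Explicit

/-! ### Uniqueness of the disks -/

section Uniqueness

variable {t : ℝ} {l : ℂ × ℂ} (hl : Nonzero l)

lemma continuous_headForm (l : ℂ × ℂ) : Continuous (headForm l) :=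
  (continuous_const.mul (continuous_apply 0)).add (continuous_const.mul (continuous_apply 1))

lemma continuous_tailForm (l : ℂ × ℂ) : Continuous (tailForm l) :=
  (continuous_const.mul (continuous_apply 3)).sub (continuous_const.mul (continuous_apply 2))

lemma differentiable_headForm (l : ℂ × ℂ) : Differentiable ℂ (headForm l) := by
  unfold headForm
  fun_prop

lemma differentiable_tailForm (l : ℂ × ℂ) : Differentiable ℂ (tailForm l) := by
  unfold tailForm
  fun_prop

lemma differentiable_skewForm (l : ℂ × ℂ) : Differentiable ℂ (skewForm l) := by
  unfold skewForm
  fun_prop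

include hl

/-- The factor of a lift of the standard disk that is smooth up to the boundary is continuous. -/
lemma continuousOn_of_smoothOn {g : ℂ → Z} (hg : SmoothOn 𝓘(ℝ, ℂ) g disk) {f : ℂ → ℂ}
    (hf : ∀ w ∈ disk, ∃ h0 : f w ≠ 0, g w = liftAt (f w) h0 t l hl w) : ContinuousOn f disk := by
  intro x hx
  obtain ⟨U, z, hU, hxU, hz, he⟩ := hg x hx
  have key : ∀ w ∈ disk ∩ U, tailForm l (z w) ≠ 0 ∧
      f w = headForm l (z w) / (Real.exp t * tailForm l (z w)) := by
    intro w hw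
    obtain ⟨hz0, e⟩ := he w hw
    obtain ⟨h0, e'⟩ := hf w hw.1
    rw [e'] at e
    exact ⟨tailForm_ne_zero h0 hl e, (eq_of_liftAt_eq h0 hl e).2⟩
  have hc : ContinuousOn (fun w => headForm l (z w) / (Real.exp t * tailForm l (z w))) (disk ∩ U) :=
    ((continuous_headForm l).comp_continuousOn hz.continuousOn).div
      (continuousOn_const.mul ((continuous_tailForm l).comp_continuousOn hz.continuousOn))
      fun w hw => mul_ne_zero (exp_ne_zero' t) (key w hw).1
  have hc' : ContinuousOn f (disk ∩ U) := hc.congr fun w hw => (key w hw).2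
  exact (continuousWithinAt_inter (hU.mem_nhds hxU)).1 (hc' x ⟨hx, hxU⟩)

/-- The factor and the base point of a holomorphic family of lifts are holomorphic. -/
lemma differentiableOn_of_holomorphicOn {g : ℂ → Z} {S : Set ℂ} (hg : HolomorphicOn g S)
    {f p : ℂ → ℂ} (hf : ∀ w ∈ S, ∃ h0 : f w ≠ 0, g w = liftAt (f w) h0 t l hl (p w)) :
    DifferentiableOn ℂ f S ∧ DifferentiableOn ℂ p S := by
  have key : ∀ x ∈ S, DifferentiableWithinAt ℂ f S x ∧ DifferentiableWithinAt ℂ p S x := by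
    intro x hx
    obtain ⟨U, z, hU, hxU, hz, he⟩ := hg x hx
    have key : ∀ w ∈ S ∩ U, headForm l (z w) ≠ 0 ∧ tailForm l (z w) ≠ 0 ∧
        p w = Real.exp t * skewForm l (z w) / headForm l (z w) ∧
        f w = headForm l (z w) / (Real.exp t * tailForm l (z w)) := by
      intro w hw
      obtain ⟨hz0, e⟩ := he w hw
      obtain ⟨h0, e'⟩ := hf w hw.1
      rw [e'] at e
      exact ⟨headForm_ne_zero h0 hl e, tailForm_ne_zero h0 hl e, eq_of_liftAt_eq h0 hl e⟩
    have h1 : DifferentiableOn ℂ (fun w => headForm l (z w)) (S ∩ U) :=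
      (differentiable_headForm l).comp_differentiableOn hz
    have h2 : DifferentiableOn ℂ (fun w => tailForm l (z w)) (S ∩ U) :=
      (differentiable_tailForm l).comp_differentiableOn hz
    have h3 : DifferentiableOn ℂ (fun w => skewForm l (z w)) (S ∩ U) :=
      (differentiable_skewForm l).comp_differentiableOn hz
    have hf' : DifferentiableOn ℂ f (S ∩ U) :=
      (h1.fun_div (h2.const_mul (Real.exp t : ℂ)) fun w hw =>
        mul_ne_zero (exp_ne_zero' t) (key w hw).2.1).congr fun w hw => (key w hw).2.2.2
    have hp' : DifferentiableOn ℂ p (S ∩ U) :=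
      ((h3.const_mul (Real.exp t : ℂ)).fun_div h1 fun w hw => (key w hw).1).congr
        fun w hw => (key w hw).2.2.1
    exact ⟨(differentiableWithinAt_inter (hU.mem_nhds hxU)).1 (hf' x ⟨hx, hxU⟩),
      (differentiableWithinAt_inter (hU.mem_nhds hxU)).1 (hp' x ⟨hx, hxU⟩)⟩
  exact ⟨fun x hx => (key x hx).1, fun x hx => (key x hx).2⟩

omit hl in
/-- An injective holomorphic map of the open disk into the closed disk avoids the boundary. -/
lemma norm_lt_one_of_injOn {p : ℂ → ℂ} (hp : DifferentiableOn ℂ p (Metric.ball 0 1))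
    (hi : Set.InjOn p (Metric.ball 0 1)) (hm : ∀ w ∈ Metric.ball (0 : ℂ) 1, p w ∈ disk) {w : ℂ}
    (hw : w ∈ Metric.ball (0 : ℂ) 1) : ‖p w‖ < 1 := by
  have ha : AnalyticOnNhd ℂ p (Metric.ball 0 1) := hp.analyticOnNhd Metric.isOpen_ball
  rcases ha.is_constant_or_isOpen (convex_ball _ _).isPreconnected with ⟨c, hc⟩ | ho
  · have h0 : (0 : ℂ) ∈ Metric.ball (0 : ℂ) 1 := Metric.mem_ball_self one_pos
    have h1 : (1 / 2 : ℂ) ∈ Metric.ball (0 : ℂ) 1 := by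
      rw [mem_ball_zero_iff]
      norm_num
    have := hi h0 h1 ((hc 0 h0).trans (hc _ h1).symm)
    norm_num at this
  · have h1 := ho _ subset_rfl Metric.isOpen_ball
    have h2 : p '' Metric.ball 0 1 ⊆ disk := by
      rintro _ ⟨v, hv, rfl⟩
      exact hm v hv
    have h3 := h1.subset_interior_iff.2 h2
    rw [interior_closedBall _ one_ne_zero] at h3
    exact mem_ball_zero_iff.1 (h3 ⟨w, hw, rfl⟩)

omit hl in
/-- A nonvanishing holomorphic function of constant modulus on the boundary is constant. -/
lemma exists_const_of_norm_eq_one {G : ℂ → ℂ} (hc : ContinuousOn G disk)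
    (hd : DifferentiableOn ℂ G (Metric.ball 0 1)) (h0 : ∀ w ∈ disk, G w ≠ 0)
    (h1 : ∀ w, ‖w‖ = 1 → ‖G w‖ = 1) : ∃ c : ℂ, ‖c‖ = 1 ∧ ∀ w ∈ disk, G w = c := by
  have hcl : closure (Metric.ball (0 : ℂ) 1) = disk := closure_ball _ one_ne_zero
  have hG : DiffContOnCl ℂ G (Metric.ball 0 1) := ⟨hd, hcl ▸ hc⟩
  have hfr : ∀ w ∈ frontier (Metric.ball (0 : ℂ) 1), ‖w‖ = 1 := fun w hw => by
    rw [frontier_ball _ one_ne_zero] at hw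
    exact mem_sphere_zero_iff_norm.1 hw
  have hle : ∀ w ∈ disk, ‖G w‖ ≤ 1 := fun w hw =>
    Complex.norm_le_of_forall_mem_frontier_norm_le Metric.isBounded_ball hG
      (fun z hz => (h1 z (hfr z hz)).le) (hcl ▸ hw)
  -- The maximum principle for 1 / G supplies the reverse inequality.
  have hge : ∀ w ∈ disk, ‖(G w)⁻¹‖ ≤ 1 := fun w hw =>
    Complex.norm_le_of_forall_mem_frontier_norm_le (f := fun w => (G w)⁻¹) Metric.isBounded_ball
      (hG.inv fun z hz => h0 z (hcl ▸ hz))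
      (fun z hz => by rw [norm_inv, h1 z (hfr z hz), inv_one]) (hcl ▸ hw)
  have heq : ∀ w ∈ disk, ‖G w‖ = 1 := fun w hw => by
    have a := hge w hw
    rw [norm_inv] at a
    exact le_antisymm (hle w hw) ((inv_le_one₀ (norm_pos_iff.2 (h0 w hw))).1 a)
  have h00 : (0 : ℂ) ∈ disk := Metric.mem_closedBall_self zero_le_one
  refine ⟨G 0, heq 0 h00, fun w hw => ?_⟩
  refine Complex.eqOn_closure_of_isPreconnected_of_isMaxOn_norm (convex_ball _ _).isPreconnected
    Metric.isOpen_ball hG (Metric.mem_ball_self one_pos) (fun z hz => ?_) (hcl ▸ hw)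
  change ‖G z‖ ≤ ‖G 0‖
  rw [heq z (Metric.ball_subset_closedBall hz), heq 0 h00]

variable {h : S2 → ℝ} (hh : ContMDiff (𝓡 2) 𝓘(ℝ, ℝ) ∞ h)

include hh in
lemma continuousOn_expAt : ContinuousOn (expAt h t l hl) disk := by
  have h1 := (contDiffOn_expAt (l := fun _ => l) (fun _ => hl) hh contDiff_const).continuousOn
  exact h1.comp (f := fun w : ℂ => ((t, (0 : ℂ)), w))
    (Continuous.prodMk_right _).continuousOn fun w hw => ⟨trivial, hw⟩

omit hl in
include hh in
/-- A holomorphic disk over a standard disk is one of the explicit disks. -/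
lemma exists_eq_explicitMap {y : S2} {D : Set Z} (hD : IsHolomorphicDisk (realSub h) D)
    (hB : MapsBiholomorphically D t y) : ∃ s : Circle, D = explicitMap h s t y '' disk := by
  obtain ⟨k, hk⟩ := hD
  obtain ⟨hbij, g, hg, hgD⟩ := hB
  have hl : Nonzero (homCoord y) := homCoord_ne_zero y
  have hDg : D = g '' disk := by
    apply Set.Subset.antisymm
    · intro p hp
      obtain ⟨w, hw, e⟩ := hbij.mapsTo hp
      exact ⟨w, hw, hbij.injOn (hgD w hw).1 hp ((hgD w hw).2.trans e)⟩
    · rintro _ ⟨w, hw, rfl⟩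
      exact (hgD w hw).1
  have hkD : ∀ v ∈ disk, k v ∈ D := fun v hv => hk.image_eq ▸ ⟨v, hv, rfl⟩
  -- Two parametrizations are in play: `k` carries the boundary condition and `g` covers the
  -- standard parametrization. The function `p` is the change of variable from `k` to `g`; its
  -- values off the disk are irrelevant.
  have hk' : ∀ v, ∃ p f : ℂ, v ∈ disk →
      p ∈ disk ∧ ∃ h0 : f ≠ 0, k v = liftAt f h0 t (homCoord y) hl p := by
    intro v
    by_cases hv : v ∈ disk
    · obtain ⟨p, hp, e⟩ := hbij.mapsTo (hkD v hv)
      obtain ⟨f, h0, e'⟩ := exists_liftAt hl e.symm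
      exact ⟨p, f, fun _ => ⟨hp, h0, e'⟩⟩
    · exact ⟨0, 0, fun h => absurd h hv⟩
  choose p f' hpf using hk'
  have hball : ∀ v ∈ Metric.ball (0 : ℂ) 1, v ∈ disk := fun v hv => Metric.ball_subset_closedBall hv
  have hpd := (differentiableOn_of_holomorphicOn hl hk.isDiskMap.2 (f := f') (p := p)
    fun v hv => (hpf v (hball v hv)).2).2
  have hproj : ∀ v ∈ disk, proj (k v) = stdMap t y (p v) := fun v hv => by
    obtain ⟨h0, e⟩ := (hpf v hv).2
    rw [e, proj_liftAt]
    rfl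
  have hpi : Set.InjOn p (Metric.ball 0 1) := fun v hv v' hv' e => by
    refine hk.injOn (hball v hv) (hball v' hv')
      (hbij.injOn (hkD v (hball v hv)) (hkD v' (hball v' hv')) ?_)
    rw [hproj v (hball v hv), hproj v' (hball v' hv'), e]
  -- The boundary condition passes from `k` to `g`: since `p` maps the open disk into itself, a
  -- boundary point of `g` can come only from a boundary point of `k`.
  have hbd : ∀ w, ‖w‖ = 1 → g w ∈ realSub h := by
    intro w hw
    have hwd : w ∈ disk := mem_closedBall_zero_iff.2 hw.le
    obtain ⟨v, hv, e⟩ : g w ∈ k '' disk := hk.image_eq.symm ▸ (hgD w hwd).1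
    have hpv : p v = w := by
      apply stdMapAt_injective (t := t) hl
      have := hproj v hv
      rw [e, (hgD w hwd).2] at this
      exact this.symm
    have hv1 : ‖v‖ = 1 := by
      refine le_antisymm (mem_closedBall_zero_iff.1 hv) (not_lt.1 fun hlt => ?_)
      have := norm_lt_one_of_injOn hpd hpi (fun u hu => (hpf u (hball u hu)).1)
        (mem_ball_zero_iff.2 hlt)
      rw [hpv, hw] at this
      exact lt_irrefl _ this
    rw [← e]
    exact hk.boundary v hv1
  have hf : ∀ w, ∃ f : ℂ, w ∈ disk → ∃ h0 : f ≠ 0, g w = liftAt f h0 t (homCoord y) hl w := by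
    intro w
    by_cases hw : w ∈ disk
    · obtain ⟨f, h0, e⟩ := exists_liftAt hl (hgD w hw).2
      exact ⟨f, fun _ => ⟨h0, e⟩⟩
    · exact ⟨0, fun h => absurd h hw⟩
  choose f hf using hf
  have hE : ∀ w, expAt h t (homCoord y) hl w ≠ 0 := fun w => Complex.exp_ne_zero _
  obtain ⟨c, hc1, hc⟩ := exists_const_of_norm_eq_one
    (G := fun w => f w / expAt h t (homCoord y) hl w)
    ((continuousOn_of_smoothOn hl hg.1 hf).div (continuousOn_expAt hl hh) fun w _ => hE w)
    (((differentiableOn_of_holomorphicOn hl hg.2 (p := id)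
      fun v hv => hf v (hball v hv)).1).fun_div (differentiableOn_expAt hh t _ hl) fun w _ => hE w)
    (fun w hw => div_ne_zero (hf w hw).1 (hE w))
    (fun w hw => by
      obtain ⟨h0, e⟩ := hf w (mem_closedBall_zero_iff.2 hw.le)
      have := hbd w hw
      rw [e, liftAt_mem_realSub_iff h0 hl h hw, ← norm_expAt hh t _ hl hw] at this
      rw [norm_div, this, div_self (norm_ne_zero_iff.2 (hE w))])
  -- The factor i compensates the -i in `factorAt`.
  have hs : ‖Complex.I * c‖ = 1 := by rw [norm_mul, Complex.norm_I, hc1, one_mul]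
  obtain ⟨s, hs'⟩ : ∃ s : Circle, (s : ℂ) = Complex.I * c :=
    ⟨⟨Complex.I * c, mem_sphere_zero_iff_norm.2 hs⟩, rfl⟩
  refine ⟨s, ?_⟩
  rw [hDg]
  refine Set.image_congr fun w hw => ?_
  obtain ⟨h0, e⟩ := hf w hw
  have e1 : f w = factorAt h s t (homCoord y) hl w := by
    have := hc w hw
    rw [div_eq_iff (hE w)] at this
    rw [this, factorAt, hs']
    linear_combination (c * expAt h t (homCoord y) hl w) * Complex.I_mul_I
  rw [e, explicitMap_eq, explicitMapAt_eq]
  congr 1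

-- The point of the first disk at w = 0 lies on the second. A lift determines both w and its factor,
-- and the factors differ only by s.
omit hl in
lemma explicitMap_param_unique {y : S2} {s s' : Circle}
    (e : explicitMap h s t y '' disk = explicitMap h s' t y '' disk) : s = s' := by
  have h0 : (0 : ℂ) ∈ disk := Metric.mem_closedBall_self zero_le_one
  obtain ⟨w, -, hw⟩ : explicitMap h s t y 0 ∈ explicitMap h s' t y '' disk := e ▸ ⟨0, h0, rfl⟩
  obtain ⟨h1, h2⟩ := liftAt_injective (factor_ne_zero h s' t y w)
    (homCoord_ne_zero y) (hf' := factor_ne_zero h s t y 0) hw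
  subst h1
  have hE : expAt h t (homCoord y) (homCoord_ne_zero y) 0 ≠ 0 := Complex.exp_ne_zero _
  exact (Circle.ext (mul_left_cancel₀ (neg_ne_zero.2 Complex.I_ne_zero)
    (mul_right_cancel₀ hE h2))).symm

end Uniqueness

/-! ### Uniqueness of the family -/

section Family

variable {h : S2 → ℝ} {l : ℂ → ℂ × ℂ} (hl : ∀ z, Nonzero (l z))

/-- The base point in the disk of the point of `Z` with homogeneous coordinates `ζ`. -/
def basePoint (l : ℂ → ℂ × ℂ) (q : ℝ × ℂ × (Fin 4 → ℂ)) : ℂ :=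
  Real.exp q.1 * skewForm (l q.2.1) q.2.2 / headForm (l q.2.1) q.2.2

/-- The parameter `s` of the explicit disk through the point with homogeneous coordinates `ζ`. -/
def phaseFun (h : S2 → ℝ) {l : ℂ → ℂ × ℂ} (hl : ∀ z, Nonzero (l z)) (q : ℝ × ℂ × (Fin 4 → ℂ)) : ℂ :=
  Complex.I * (headForm (l q.2.1) q.2.2 / (Real.exp q.1 * tailForm (l q.2.1) q.2.2)) *
    (expAt h q.1 (l q.2.1) (hl _) (basePoint l q))⁻¹

/-- The domain of `phaseFun`. -/
def phaseDomain (l : ℂ → ℂ × ℂ) : Set (ℝ × ℂ × (Fin 4 → ℂ)) :=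
  {q | headForm (l q.2.1) q.2.2 ≠ 0 ∧ tailForm (l q.2.1) q.2.2 ≠ 0 ∧ basePoint l q ∈ disk}

lemma contDiffOn_phaseFun (hh : ContMDiff (𝓡 2) 𝓘(ℝ, ℝ) ∞ h) (hl' : ContDiff ℝ ∞ l) :
    ContDiffOn ℝ ∞ (phaseFun h hl) (phaseDomain l) := by
  have h1 : ContDiff ℝ ∞ (fun q : ℝ × ℂ × (Fin 4 → ℂ) => (l q.2.1).1) :=
    contDiff_fst.comp (hl'.comp (contDiff_fst.comp contDiff_snd))
  have h2 : ContDiff ℝ ∞ (fun q : ℝ × ℂ × (Fin 4 → ℂ) => (l q.2.1).2) :=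
    contDiff_snd.comp (hl'.comp (contDiff_fst.comp contDiff_snd))
  have h3 : ContDiff ℝ ∞ (fun q : ℝ × ℂ × (Fin 4 → ℂ) => (Real.exp q.1 : ℂ)) :=
    Complex.ofRealCLM.contDiff.comp (Real.contDiff_exp.comp contDiff_fst)
  have hζ : ∀ i, ContDiff ℝ ∞ (fun q : ℝ × ℂ × (Fin 4 → ℂ) => q.2.2 i) :=
    fun i => (contDiff_apply ℝ ℂ i).comp (contDiff_snd.comp contDiff_snd)
  have hconj : ∀ {f : ℝ × ℂ × (Fin 4 → ℂ) → ℂ}, ContDiff ℝ ∞ f →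
      ContDiff ℝ ∞ (fun q => conj (f q)) := fun hf => Complex.conjCLE.contDiff.comp hf
  have hhead : ContDiff ℝ ∞ (fun q : ℝ × ℂ × (Fin 4 → ℂ) => headForm (l q.2.1) q.2.2) :=
    ((hconj h1).mul (hζ 0)).add ((hconj h2).mul (hζ 1))
  have htail : ContDiff ℝ ∞ (fun q : ℝ × ℂ × (Fin 4 → ℂ) => tailForm (l q.2.1) q.2.2) :=
    ((hconj h2).mul (hζ 3)).sub ((hconj h1).mul (hζ 2))
  have hskew : ContDiff ℝ ∞ (fun q : ℝ × ℂ × (Fin 4 → ℂ) => skewForm (l q.2.1) q.2.2) :=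
    (h2.mul (hζ 0)).sub (h1.mul (hζ 1))
  have hbase : ContDiffOn ℝ ∞ (basePoint l) (phaseDomain l) := by
    unfold basePoint
    simp only [div_eq_mul_inv]
    exact (h3.mul hskew).contDiffOn.mul (hhead.contDiffOn.inv fun q hq => hq.1)
  have hE : ContDiffOn ℝ ∞ (fun q => expAt h q.1 (l q.2.1) (hl _) (basePoint l q))
      (phaseDomain l) := by
    have h4 := (contDiff_fst.prodMk (contDiff_fst.comp contDiff_snd)).contDiffOn.prodMk hbase
    have h5 := (contDiffOn_expAt hl hh hl').comp h4 fun q hq => ⟨trivial, hq.2.2⟩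
    exact h5
  unfold phaseFun
  simp only [div_eq_mul_inv]
  exact (contDiffOn_const.mul (hhead.contDiffOn.mul ((h3.mul htail).contDiffOn.inv
    fun q hq => mul_ne_zero (exp_ne_zero' _) hq.2.1))).mul
    (hE.inv fun q _ => Complex.exp_ne_zero _)

/-- The forms recover w and the factor -i s e^{2H₊ + H₀} from ζ; multiplying by i and dividing out
the exponential at w leaves s. -/
lemma phaseFun_eq {s : Circle} {t : ℝ} {x : ℂ} {ζ : Fin 4 → ℂ} {hζ : ζ ≠ 0} {w : ℂ} (hw : w ∈ disk)
    (e : (explicitMapAt h s t (l x) (hl x) w).1 = Projectivization.mk ℂ ζ hζ) :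
    (t, x, ζ) ∈ phaseDomain l ∧ phaseFun h hl (t, x, ζ) = s := by
  rw [explicitMapAt_eq] at e
  obtain ⟨e1, e2⟩ := eq_of_liftAt_eq _ _ e
  have hb : basePoint l (t, x, ζ) = w := e1.symm
  refine ⟨⟨headForm_ne_zero _ _ e, tailForm_ne_zero _ _ e, hb.symm ▸ hw⟩, ?_⟩
  have hE : expAt h t (l x) (hl x) w ≠ 0 := Complex.exp_ne_zero _
  unfold phaseFun
  rw [hb]
  simp only
  rw [← e2, factorAt, mul_inv_eq_iff_eq_mul₀ hE]
  linear_combination (-(s : ℂ) * expAt h t (l x) (hl x) w) * Complex.I_mul_I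

/-- The parameter `s` of a smooth family of explicit disks depends smoothly on the index. -/
lemma contMDiff_phase (hh : ContMDiff (𝓡 2) 𝓘(ℝ, ℝ) ∞ h) {D : Param → Set Z}
    (hD : IsSmoothDiskFamily (realSub h) D) {σ : Param → Circle}
    (hσ : ∀ m : Param, D m = explicitMap h (σ m) m.2.1 m.2.2 '' disk) :
    ContMDiff paramModel (𝓡 1) ∞ σ := by
  have hfact := finrank_real_complex_fact'
  suffices hcoe : ContMDiff paramModel 𝓘(ℝ, ℂ) ∞ (fun m => (σ m : ℂ)) by
    exact hcoe.codRestrict_sphere (n := 1) fun m => (σ m).2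
  intro m₀
  obtain ⟨l, z, V, hl, hl', hV, hyV, hz, hc⟩ := exists_local_coord m₀.2.2
  obtain ⟨U, F, hU, hmU, hF, hpar⟩ := hD m₀
  have h0 : (0 : ℂ) ∈ disk := Metric.mem_closedBall_self zero_le_one
  -- One point of each disk suffices to read off s. The centre of the given parametrization is used;
  -- its base point in the standard disk need not be 0.
  obtain ⟨W, ζ, hW, hmW, hζ, he⟩ := hF (m₀, 0) ⟨hmU, h0⟩
  let N : Set Param := {m | m ∈ U ∧ m.2.2 ∈ V ∧ (m, (0 : ℂ)) ∈ W}
  have hN : IsOpen N := hU.inter ((hV.preimage (continuous_snd.comp continuous_snd)).inter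
    (hW.preimage (Continuous.prodMk_left (0 : ℂ))))
  have hmN : m₀ ∈ N := ⟨hmU, hyV, hmW⟩
  have hpt : ContMDiff paramModel 𝓘(ℝ, ℝ) ∞ (fun m : Param => m.2.1) :=
    contMDiff_fst.comp contMDiff_snd
  have hpy : ContMDiff paramModel (𝓡 2) ∞ (fun m : Param => m.2.2) :=
    contMDiff_snd.comp contMDiff_snd
  have hpz : ContMDiffOn paramModel 𝓘(ℝ, ℂ) ∞ (fun m : Param => z m.2.2) N :=
    hz.comp hpy.contMDiffOn fun m hm => hm.2.1
  have hpζ : ContMDiffOn paramModel 𝓘(ℝ, Fin 4 → ℂ) ∞ (fun m : Param => ζ (m, 0)) N :=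
    hζ.comp (contMDiff_id.prodMk contMDiff_const).contMDiffOn
      fun m hm => ⟨⟨hm.1, h0⟩, hm.2.2⟩
  have hq1 := hpz.prodMk_space hpζ
  have hq : ContMDiffOn paramModel 𝓘(ℝ, ℝ × ℂ × (Fin 4 → ℂ)) ∞
      (fun m : Param => (m.2.1, z m.2.2, ζ (m, 0))) N := hpt.contMDiffOn.prodMk_space hq1
  have key : ∀ m ∈ N, (m.2.1, z m.2.2, ζ (m, 0)) ∈ phaseDomain l ∧
      phaseFun h hl (m.2.1, z m.2.2, ζ (m, 0)) = σ m := by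
    intro m hm
    obtain ⟨c, hc0, ec⟩ := hc m.2.2 hm.2.1
    obtain ⟨hζ0, eζ⟩ := he (m, 0) ⟨⟨hm.1, h0⟩, hm.2.2⟩
    have hmem : F (m, 0) ∈ D m := (hpar m hm.1).image_eq ▸ ⟨0, h0, rfl⟩
    rw [hσ m, ← image_explicitMapAt_eq h (σ m) m.2.1 m.2.2 (hl (z m.2.2)) hc0 ec] at hmem
    obtain ⟨w, hw, ew⟩ := hmem
    rw [← ew] at eζ
    exact phaseFun_eq hl hw eζ
  have h5 := (contDiffOn_phaseFun hl hh hl').contMDiffOn.comp hq fun m hm => (key m hm).1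
  have h6 : ContMDiffOn paramModel 𝓘(ℝ, ℂ) ∞ (fun m => (σ m : ℂ)) N :=
    h5.congr fun m hm => (key m hm).2.symm
  exact h6.contMDiffAt (hN.mem_nhds hmN)

lemma IsSmoothDiskFamily.isHolomorphicDisk {P : Set Z} {D : Param → Set Z}
    (hD : IsSmoothDiskFamily P D) (m : Param) : IsHolomorphicDisk P (D m) := by
  obtain ⟨U, F, -, hm, -, hp⟩ := hD m
  exact ⟨_, hp m hm⟩

end Family

end TwistorDisks

end

/-! ### The main theorem -/

theorem mainTheorem8 (h : TwistorDisks.S2 → ℝ)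
    (hh : ContMDiff (𝓡 2) 𝓘(ℝ, ℝ) ∞ h) :
    ∃ D : TwistorDisks.Param → Set TwistorDisks.Z,
      -- a smooth family of holomorphic disks with boundaries on `P_h`, lifting the standard disks
      TwistorDisks.IsSmoothDiskFamily (TwistorDisks.realSub h) D ∧
      (∀ s t y, TwistorDisks.MapsBiholomorphically (D (s, t, y)) t y) ∧
      -- the Fourier splitting `H = H₋ + H₀ + H₊` along the boundary circle
      (∀ (t : ℝ) (y : TwistorDisks.S2) (w : ℂ), ‖w‖ = 1 →
        Summable (fun k : ℤ => TwistorDisks.coeff h t y k * w ^ k) ∧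
        (TwistorDisks.bdryFun h t y w : ℂ) =
          TwistorDisks.Hminus h t y w + TwistorDisks.coeff h t y 0 +
            TwistorDisks.Hplus h t y w) ∧
      -- the explicit formula
      (∀ s t y, D (s, t, y) = TwistorDisks.explicitMap h s t y '' TwistorDisks.disk) ∧
      -- uniqueness of the disks: every lift of a standard disk is a member, for a unique `s`
      (∀ (t : ℝ) (y : TwistorDisks.S2) (D' : Set TwistorDisks.Z),
        TwistorDisks.IsHolomorphicDisk (TwistorDisks.realSub h) D' →
        TwistorDisks.MapsBiholomorphically D' t y →
        ∃! s : Circle, D' = D (s, t, y)) ∧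
      -- uniqueness of the smooth family, up to a smooth change of the parameter `s`
      (∀ D' : TwistorDisks.Param → Set TwistorDisks.Z,
        TwistorDisks.IsSmoothDiskFamily (TwistorDisks.realSub h) D' →
        (∀ s t y, TwistorDisks.MapsBiholomorphically (D' (s, t, y)) t y) →
        ∃! σ : TwistorDisks.Param → Circle,
          ContMDiff TwistorDisks.paramModel (𝓡 1) ∞ σ ∧
          ∀ s t y, D' (s, t, y) = D (σ (s, t, y), t, y)) := by
  refine ⟨fun m => TwistorDisks.explicitMap h m.1 m.2.1 m.2.2 '' TwistorDisks.disk,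
    TwistorDisks.isSmoothDiskFamily_explicitMap hh,
    fun s t y => TwistorDisks.mapsBiholomorphically_explicitMap hh s t y,
    fun t y w hw => ⟨(TwistorDisks.hasSum_coeffAt hh t _ (TwistorDisks.homCoord_ne_zero y)
      hw).summable, TwistorDisks.bdryFunAt_eq_sum hh t _ (TwistorDisks.homCoord_ne_zero y) hw⟩,
    fun _ _ _ => rfl, fun t y D' hD hB => ?_, fun D' hD hB => ?_⟩
  · obtain ⟨s, hs⟩ := TwistorDisks.exists_eq_explicitMap hh hD hB
    exact ⟨s, hs, fun s' hs' => TwistorDisks.explicitMap_param_unique (hs'.symm.trans hs)⟩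
  · have hex : ∀ m : TwistorDisks.Param, ∃ s : Circle,
        D' m = TwistorDisks.explicitMap h s m.2.1 m.2.2 '' TwistorDisks.disk := fun m =>
      TwistorDisks.exists_eq_explicitMap hh (hD.isHolomorphicDisk m) (hB m.1 m.2.1 m.2.2)
    -- The choice is forced by `explicitMap_param_unique`, which is why smoothness can be proved for
    -- it afterwards.
    choose σ hσ using hex
    refine ⟨σ, ⟨TwistorDisks.contMDiff_phase hh hD hσ, fun s t y => hσ (s, t, y)⟩,
      fun σ' hσ' => funext fun m => ?_⟩
    exact TwistorDisks.explicitMap_param_unique ((hσ'.2 m.1 m.2.1 m.2.2).symm.trans (hσ m))
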